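/- Let $A$ be a unital C*-algebra, let $G$ be a compact (Hausdorff) abelian group, and let $\alpha,\beta$ be (point-norm continuous) actions of $G$ on $A$. Write $A\rtimes_\alpha G$ for the crossed product, $\lambda$ for the canonical unitary representation of $G$ in its multiplier algebra, $\widehat\alpha$ for the dual action of $\widehat G$ on $A\rtimes_\alpha G$ (so that $\widehat\alpha(s)$ fixes $A$ and multiplies $\lambda_t$ by $\langle t,s\rangle$), $P_\alpha(s)$, $s\in\widehat G$, for the spectral projections of $\lambda$, so that $\lambda_t=\sum_{s\in\widehat G}\langle t,s\rangle P_\alpha(s)$, and $\iota_*\colon K_i(A\rtimes_\alpha G)\to K_i(A)$, $i=0,1$, for the composition of the homomorphism induced by the canonical inclusion $\iota\colon A\rtimes_\alpha G\subset A\otimes\mathcal K(L^2(G))$ with the stability isomorphism $K_i(A\otimes\mathcal K(L^2(G)))\cong K_i(A)$; similarly for $\beta$. Suppose that $\alpha$ and $\beta$ are conjugate, i.e. there is a $*$-automorphism $\sigma$ of $A$ with $\alpha_t=\sigma\beta_t\sigma^{-1}$ for all $t\in G$. Then for $i=0,1$ there are group isomorphisms $\varphi_1$ of $K_i(A\rtimes_\alpha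 G)$ onto $K_i(A\rtimes_\beta G)$ and $\varphi_2$ of $K_i(A)$ onto $K_i(A)$ such that $$\iota_*\varphi_1=\varphi_2\,\iota_*,\qquad \varphi_1\,\widehat\alpha(s)_*=\widehat\beta(s)_*\,\varphi_1\quad(s\in\widehat G),$$ and such that, for $i=0$, also $\varphi_1([P_\alpha(0)])=[P_\beta(0)]$, and $\varphi_1$ and $\varphi_2$ are order isomorphisms: $\varphi_1$ maps the positive cone $K_0(A\rtimes_\alpha G)^+$ onto $K_0(A\rtimes_\beta G)^+$, and $\varphi_2$ maps $K_0(A)^+$ onto itself, where $K_0(B)^+$ is the set of classes of projections in the matrix algebras over $B$. -/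

import Mathlib

open scoped Matrix

/-! ## K-theory of C⋆-algebras -/

namespace KTheory

section Matrices

variable {R : Type*} [Ring R] [StarRing R] {ι κ l : Type*} [Fintype ι] [Fintype κ] [Fintype l]

/-- Murray--von Neumann equivalence of square matrices, possibly of different sizes:
`p = v⋆v` and `q = vv⋆` for some rectangular matrix `v`. -/
def MvN (p : Matrix ι ι R) (q : Matrix κ κ R) : Prop :=
  ∃ v : Matrix κ ι R, vᴴ * v = p ∧ v * vᴴ = q

/-- A projection in a matrix algebra: `p = p² = p⋆`. -/
def IsProj {R : Type*} [NonUnitalRing R] [StarRing R] (p : Matrix ι ι R) : Prop :=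
  p * p = p ∧ pᴴ = p


theorem MvN.refl {p : Matrix ι ι R} (hp : IsProj p) : MvN p p :=
  ⟨p, by rw [hp.2, hp.1], by rw [hp.2, hp.1]⟩

theorem MvN.symm {p : Matrix ι ι R} {q : Matrix κ κ R} (h : MvN p q) : MvN q p := by
  obtain ⟨v, h1, h2⟩ := h
  exact ⟨vᴴ, by simpa using h2, by simpa using h1⟩

theorem MvN.trans {p : Matrix ι ι R} {q : Matrix κ κ R} {r : Matrix l l R}
    (hp : IsProj p) (hr : IsProj r) (h : MvN p q) (h' : MvN q r) : MvN p r := by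
  obtain ⟨v, h1, h2⟩ := h
  obtain ⟨w, h3, h4⟩ := h'
  refine ⟨w * v, ?_, ?_⟩
  · calc (w * v)ᴴ * (w * v) = vᴴ * (wᴴ * w) * v := by
          simp only [Matrix.conjTranspose_mul, Matrix.mul_assoc]
      _ = (vᴴ * v) * (vᴴ * v) := by rw [h3, ← h2]; simp only [Matrix.mul_assoc]
      _ = p := by rw [h1, hp.1]
  · calc (w * v) * (w * v)ᴴ = w * (v * vᴴ) * wᴴ := by
          simp only [Matrix.conjTranspose_mul, Matrix.mul_assoc]
      _ = (w * wᴴ) * (w * wᴴ) := by rw [h2, ← h3]; simp only [Matrix.mul_assoc]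
      _ = r := by rw [h4, hr.1]

/-- Relabelling the index set does not change the Murray--von Neumann class. -/
theorem MvN.submatrix {p : Matrix ι ι R} (hp : IsProj p) (e : κ ≃ ι) :
    MvN p (p.submatrix e e) := by
  refine ⟨p.submatrix e id, ?_, ?_⟩
  · rw [Matrix.conjTranspose_submatrix, hp.2, Matrix.submatrix_mul_equiv, hp.1]
    rfl
  · rw [Matrix.conjTranspose_submatrix, hp.2]
    have := Matrix.submatrix_mul_equiv p p (e : κ → ι) (Equiv.refl ι) (e : κ → ι)
    rw [hp.1] at this
    exact this

theorem IsProj.submatrix {p : Matrix ι ι R} (hp : IsProj p) (e : κ ≃ ι) :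
    IsProj (p.submatrix e e) := by
  refine ⟨?_, by rw [Matrix.conjTranspose_submatrix, hp.2]⟩
  rw [Matrix.submatrix_mul_equiv, hp.1]

theorem IsProj.fromBlocks {p : Matrix ι ι R} {q : Matrix κ κ R} (hp : IsProj p)
    (hq : IsProj q) : IsProj (Matrix.fromBlocks p 0 0 q) := by
  refine ⟨?_, ?_⟩
  · simp [Matrix.fromBlocks_multiply, hp.1, hq.1]
  · simp [Matrix.fromBlocks_conjTranspose, hp.2, hq.2]

theorem MvN.fromBlocks {ι' κ' : Type*} [Fintype ι'] [Fintype κ'] {p : Matrix ι ι R}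
    {q : Matrix κ κ R} {p' : Matrix ι' ι' R} {q' : Matrix κ' κ' R}
    (h : MvN p p') (h' : MvN q q') :
    MvN (Matrix.fromBlocks p 0 0 q) (Matrix.fromBlocks p' 0 0 q') := by
  obtain ⟨v, h1, h2⟩ := h
  obtain ⟨w, h3, h4⟩ := h'
  refine ⟨Matrix.fromBlocks v 0 0 w, ?_, ?_⟩ <;>
    simp [Matrix.fromBlocks_multiply, Matrix.fromBlocks_conjTranspose, *]

end Matrices

section KZero

/-- Projections in the matrix algebras `M_n(R)`, `n = 0, 1, 2, …`. -/
structure ProjMat (R : Type*) [Ring R] [StarRing R] where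
  n : ℕ
  mat : Matrix (Fin n) (Fin n) R
  isProj : IsProj mat

variable (R S : Type*) [Ring R] [StarRing R] [Ring S] [StarRing S]

instance ProjMat.setoid : Setoid (ProjMat R) where
  r p q := MvN p.mat q.mat
  iseqv := ⟨fun p => MvN.refl p.isProj, fun h => h.symm,
    fun {p _ r} h h' => MvN.trans p.isProj r.isProj h h'⟩

/-- The Murray--von Neumann semigroup `V(R)`. -/
def V : Type _ := Quotient (ProjMat.setoid R)

variable {R S}

/-- The class in `V(R)` of a projection. -/
def V.mk {n : ℕ} (p : Matrix (Fin n) (Fin n) R) (hp : IsProj p) : V R :=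
  Quotient.mk _ ⟨n, p, hp⟩

/-- The direct sum `diag(p, q)`. -/
def ProjMat.sum (p q : ProjMat R) : ProjMat R where
  n := p.n + q.n
  mat := (Matrix.fromBlocks p.mat 0 0 q.mat).submatrix finSumFinEquiv.symm finSumFinEquiv.symm
  isProj := (p.isProj.fromBlocks q.isProj).submatrix _

theorem ProjMat.sum_mvN (p q : ProjMat R) :
    MvN (Matrix.fromBlocks p.mat 0 0 q.mat) (p.sum q).mat :=
  MvN.submatrix (p.isProj.fromBlocks q.isProj) _

theorem ProjMat.equiv_of_mvN {ι : Type*} [Fintype ι] {p q : ProjMat R} {a b : Matrix ι ι R}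
    (hab : a = b) (h : MvN a p.mat) (h' : MvN b q.mat) : p ≈ q := by
  subst hab
  exact MvN.trans p.isProj q.isProj h.symm h'

instance : Add (V R) where
  add := Quotient.map₂ ProjMat.sum fun p p' h q q' h' =>
    MvN.trans (ProjMat.isProj _) (ProjMat.isProj _) (ProjMat.sum_mvN p q).symm
      (MvN.trans (p.isProj.fromBlocks q.isProj) (ProjMat.isProj _) (MvN.fromBlocks h h')
        (ProjMat.sum_mvN p' q'))

instance : Zero (V R) where
  zero := V.mk (0 : Matrix (Fin 0) (Fin 0) R) ⟨by simp, by simp⟩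

theorem V.add_comm' (x y : V R) : x + y = y + x := by
  induction x using Quotient.inductionOn with | _ p
  induction y using Quotient.inductionOn with | _ q
  refine Quotient.sound (ProjMat.equiv_of_mvN rfl (ProjMat.sum_mvN p q) ?_)
  refine MvN.trans (p.isProj.fromBlocks q.isProj) (ProjMat.isProj _)
    (MvN.submatrix (p.isProj.fromBlocks q.isProj) (Equiv.sumComm (Fin q.n) (Fin p.n))) ?_
  rw [Equiv.sumComm_apply, Matrix.fromBlocks_submatrix_sum_swap_sum_swap]
  exact ProjMat.sum_mvN q p

theorem V.add_assoc' (x y z : V R) : x + y + z = x + (y + z) := by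
  induction x using Quotient.inductionOn with | _ p
  induction y using Quotient.inductionOn with | _ q
  induction z using Quotient.inductionOn with | _ r
  have h1 : MvN (Matrix.fromBlocks (Matrix.fromBlocks p.mat 0 0 q.mat) 0 0 r.mat)
      ((p.sum q).sum r).mat :=
    MvN.trans ((p.isProj.fromBlocks q.isProj).fromBlocks r.isProj) (ProjMat.isProj _)
      (MvN.fromBlocks (ProjMat.sum_mvN p q) (MvN.refl r.isProj)) (ProjMat.sum_mvN _ _)
  have h2 : MvN (Matrix.fromBlocks p.mat 0 0 (Matrix.fromBlocks q.mat 0 0 r.mat))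
      (p.sum (q.sum r)).mat :=
    MvN.trans (p.isProj.fromBlocks (q.isProj.fromBlocks r.isProj)) (ProjMat.isProj _)
      (MvN.fromBlocks (MvN.refl p.isProj) (ProjMat.sum_mvN q r)) (ProjMat.sum_mvN _ _)
  have h3 := MvN.submatrix (p.isProj.fromBlocks (q.isProj.fromBlocks r.isProj))
    (Equiv.sumAssoc (Fin p.n) (Fin q.n) (Fin r.n))
  refine Quotient.sound (ProjMat.equiv_of_mvN ?_ h1
    (MvN.trans ?_ (ProjMat.isProj _) h3.symm h2))
  · ext (( i | i) | i) ((j | j) | j) <;> rfl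
  · exact (p.isProj.fromBlocks (q.isProj.fromBlocks r.isProj)).submatrix _

/-- A zero block may be dropped. -/
theorem V.zero_add' (x : V R) : 0 + x = x := by
  induction x using Quotient.inductionOn with | _ p
  refine Quotient.sound ?_
  refine MvN.trans (ProjMat.isProj _) p.isProj (ProjMat.sum_mvN _ p).symm ?_
  refine ⟨Matrix.of fun i j => Sum.elim (fun _ => 0) (fun j => p.mat i j) j, ?_, ?_⟩
  · have h1 := congrFun₂ (p.isProj.1)
    have h2 := congrFun₂ (p.isProj.2)
    ext (i | i) (j | j)
    · exact i.elim0
    · exact i.elim0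
    · exact j.elim0
    · simp only [Matrix.mul_apply, Matrix.conjTranspose_apply, Matrix.of_apply, Sum.elim_inr] at *
      simp only [h2]
      exact h1 i j
  · have h1 := congrFun₂ (p.isProj.1)
    have h2 := congrFun₂ (p.isProj.2)
    ext i j
    simp only [Matrix.mul_apply, Matrix.conjTranspose_apply, Matrix.of_apply, Fintype.sum_sum_type,
      Sum.elim_inr, Sum.elim_inl] at *
    simp only [h2]
    simpa using h1 i j

instance : AddCommMonoid (V R) where
  add_assoc := V.add_assoc'
  zero_add := V.zero_add'
  add_zero x := by rw [V.add_comm', V.zero_add']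
  add_comm := V.add_comm'
  nsmul := nsmulRec

theorem IsProj.map {R S : Type*} [NonUnitalRing R] [StarRing R] [NonUnitalRing S] [StarRing S]
    {F : Type*} [FunLike F R S] [NonUnitalRingHomClass F R S] [StarHomClass F R S]
    {ι : Type*} [Fintype ι] {p : Matrix ι ι R} (hp : IsProj p) (f : F) : IsProj (p.map f) := by
  refine ⟨?_, ?_⟩
  · ext i j
    have := congrArg f (congrFun₂ hp.1 i j)
    simpa [Matrix.mul_apply, map_sum] using this
  · ext i j
    have := congrArg f (congrFun₂ hp.2 i j)
    simpa [map_star] using this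

variable [Algebra ℂ R] [Algebra ℂ S]

theorem MvN.map {ι κ : Type*} [Fintype ι] [Fintype κ] {p : Matrix ι ι R} {q : Matrix κ κ R}
    (h : MvN p q) (f : R →⋆ₐ[ℂ] S) : MvN (p.map f) (q.map f) := by
  obtain ⟨v, h1, h2⟩ := h
  refine ⟨v.map f, ?_, ?_⟩
  · rw [← Matrix.conjTranspose_map f (map_star f), ← Matrix.map_mul, h1]
  · rw [← Matrix.conjTranspose_map f (map_star f), ← Matrix.map_mul, h2]

/-- A unital ⋆-homomorphism maps projections to projections, entrywise. -/
def ProjMat.map (f : R →⋆ₐ[ℂ] S) (p : ProjMat R) : ProjMat S := ⟨p.n, p.mat.map f, p.isProj.map f⟩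

/-- The homomorphism `V(R) → V(S)` induced by a unital ⋆-homomorphism. -/
def V.map (f : R →⋆ₐ[ℂ] S) : V R →+ V S where
  toFun := Quotient.map (ProjMat.map f) fun _ _ h => h.map f
  map_zero' := by
    refine Quotient.sound ?_
    exact MvN.symm ⟨0, by ext i; exact i.elim0, by ext i; exact i.elim0⟩
  map_add' x y := by
    induction x using Quotient.inductionOn with | _ p
    induction y using Quotient.inductionOn with | _ q
    refine congrArg (Quotient.mk _) ?_
    simp only [ProjMat.map, ProjMat.sum, ProjMat.mk.injEq, heq_eq_eq, true_and]
    rw [← Matrix.submatrix_map, Matrix.fromBlocks_map]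
    simp
    rfl

variable (R) in
/-- The Grothendieck group of `V(R)`, for a unital algebra `R`. -/
abbrev K₀₀ : Type _ := Algebra.GrothendieckAddGroup (V R)

/-- The homomorphism `K₀₀(R) → K₀₀(S)` induced by a unital ⋆-homomorphism. -/
noncomputable def K₀₀.map (f : R →⋆ₐ[ℂ] S) : K₀₀ R →+ K₀₀ S :=
  Algebra.GrothendieckAddGroup.lift (Algebra.GrothendieckAddGroup.of.comp (V.map f))

end KZero

section KZeroNonunital

variable (A B : Type*) [NonUnitalCStarAlgebra A] [NonUnitalCStarAlgebra B]

/-- The scalar part `A⁺ → ℂ` on the unitization of `A`. -/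
def scalarPart : Unitization ℂ A →⋆ₐ[ℂ] ℂ where
  toAlgHom := Unitization.fstHom ℂ A
  map_star' _ := rfl

/-- The group `K₀(A) = ker(K₀₀(A⁺) → K₀₀(ℂ))` of a C⋆-algebra `A`, unital or not. -/
def K₀ : Type _ := (K₀₀.map (scalarPart A)).ker

noncomputable instance : AddCommGroup (K₀ A) :=
  inferInstanceAs (AddCommGroup (K₀₀.map (scalarPart A)).ker)

variable {A B}

theorem scalarPart_comp_starMap (f : A →⋆ₙₐ[ℂ] B) :
    (scalarPart B).comp (Unitization.starMap f) = scalarPart A := by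
  ext x
  change (Unitization.starMap f (Unitization.inr x)).fst = (Unitization.inr x : Unitization ℂ A).fst
  simp

theorem V.map_map {R S T : Type*} [Ring R] [StarRing R] [Ring S] [StarRing S] [Ring T] [StarRing T]
    [Algebra ℂ R] [Algebra ℂ S] [Algebra ℂ T] (f : R →⋆ₐ[ℂ] S) (g : S →⋆ₐ[ℂ] T) (x : V R) :
    V.map g (V.map f x) = V.map (g.comp f) x := by
  induction x using Quotient.inductionOn with | _ p
  rfl

theorem K₀₀.map_of {R S : Type*} [Ring R] [StarRing R] [Ring S] [StarRing S]
    [Algebra ℂ R] [Algebra ℂ S] (f : R →⋆ₐ[ℂ] S) (x : V R) :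
    K₀₀.map f (Algebra.GrothendieckAddGroup.of x) = Algebra.GrothendieckAddGroup.of (V.map f x) :=
  DFunLike.congr_fun (Algebra.GrothendieckAddGroup.lift.symm_apply_apply
    ((Algebra.GrothendieckAddGroup.of (M := V S)).comp (V.map f))) x

theorem K₀₀.map_map {R S T : Type*} [Ring R] [StarRing R] [Ring S] [StarRing S] [Ring T]
    [StarRing T] [Algebra ℂ R] [Algebra ℂ S] [Algebra ℂ T] (f : R →⋆ₐ[ℂ] S) (g : S →⋆ₐ[ℂ] T)
    (x : K₀₀ R) : K₀₀.map g (K₀₀.map f x) = K₀₀.map (g.comp f) x := by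
  have : (K₀₀.map g).comp (K₀₀.map f) = K₀₀.map (g.comp f) := by
    apply Algebra.GrothendieckAddGroup.lift.symm.injective
    ext x
    change K₀₀.map g (K₀₀.map f (Algebra.GrothendieckAddGroup.of x)) =
      K₀₀.map (g.comp f) (Algebra.GrothendieckAddGroup.of x)
    rw [K₀₀.map_of, K₀₀.map_of, K₀₀.map_of, V.map_map]
  exact DFunLike.congr_fun this x

/-- The homomorphism `f_* : K₀(A) → K₀(B)` induced by a ⋆-homomorphism `f : A → B`. -/
noncomputable def K₀.map (f : A →⋆ₙₐ[ℂ] B) : K₀ A →+ K₀ B :=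
  ((K₀₀.map (Unitization.starMap f)).comp (K₀₀.map (scalarPart A)).ker.subtype).codRestrict _
    fun x => by
      rw [AddMonoidHom.mem_ker, AddMonoidHom.comp_apply, K₀₀.map_map, scalarPart_comp_starMap]
      exact x.2

/-- The class in `K₀(A)` of a projection in a matrix algebra `M_n(A)`. -/
noncomputable def K₀.ofProj {n : ℕ} (p : Matrix (Fin n) (Fin n) A) (hp : IsProj p) : K₀ A :=
  ⟨Algebra.GrothendieckAddGroup.of
    (V.mk (p.map (Unitization.inrNonUnitalStarAlgHom ℂ A)) (hp.map _)), by
      rw [AddMonoidHom.mem_ker, K₀₀.map_of]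
      convert! map_zero (Algebra.GrothendieckAddGroup.of (M := V ℂ))
      refine Quotient.sound (MvN.symm ⟨0, by ext i; exact i.elim0, ?_⟩)
      ext i j
      simp only [Matrix.zero_mul, Matrix.zero_apply]
      rfl⟩

/-- The class in `K₀(A)` of a projection `p ∈ A`. -/
noncomputable def K₀.ofElem (p : A) (hp : IsStarProjection p) : K₀ A :=
  K₀.ofProj (n := 1) (Matrix.of fun _ _ => p) ⟨by
    ext i j
    simpa [Matrix.mul_apply] using hp.isIdempotentElem.eq, by
    ext i j
    simpa using hp.isSelfAdjoint.star_eq⟩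

variable (A) in
/-- The positive cone `K₀(A)⁺` of classes of projections in the matrix algebras over `A`. -/
def K₀.pos : Set (K₀ A) :=
  {x | ∃ (n : ℕ) (p : Matrix (Fin n) (Fin n) A) (hp : IsProj p), x = K₀.ofProj p hp}

end KZeroNonunital

section KOne

variable (R S : Type*) [CStarAlgebra R] [CStarAlgebra S]

/-- The unitary group `U_n(R)`, with the norm topology of `M_n(R)` (the topology of entrywise
convergence). -/
abbrev U (n : ℕ) : Type _ := unitary (Matrix (Fin n) (Fin n) R)

variable {R S}

variable (R) in
/-- The isometry given by the first `m` columns of the unit matrix of size `n`. -/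
def colMat {m n : ℕ} (h : m ≤ n) : Matrix (Fin n) (Fin m) R :=
  Matrix.of fun i j => if i = Fin.castLE h j then 1 else 0

theorem colMat_isometry {m n : ℕ} (h : m ≤ n) : (colMat R h)ᴴ * colMat R h = 1 := by
  ext i j
  simp [colMat, Matrix.mul_apply, Matrix.one_apply, apply_ite star, eq_comm]

theorem colMat_self (n : ℕ) : colMat R (le_refl n) = 1 := by
  ext i j
  simp [colMat, Matrix.one_apply]

theorem colMat_mul {l m n : ℕ} (h : l ≤ m) (h' : m ≤ n) :
    colMat R h' * colMat R h = colMat R (h.trans h') := by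
  ext i j
  simp [colMat, Matrix.mul_apply]

/-- The block matrix `diag(u, 1)` of size `n`. -/
def padMat {m n : ℕ} (h : m ≤ n) (u : Matrix (Fin m) (Fin m) R) : Matrix (Fin n) (Fin n) R :=
  colMat R h * u * (colMat R h)ᴴ + (1 - colMat R h * (colMat R h)ᴴ)

theorem padMat_mul {m n : ℕ} (h : m ≤ n) (u v : Matrix (Fin m) (Fin m) R) :
    padMat h (u * v) = padMat h u * padMat h v := by
  have hV := colMat_isometry (R := R) h
  unfold padMat
  generalize colMat R h = w at hV
  have e1 : w * u * wᴴ * (w * v * wᴴ) = w * (u * v) * wᴴ := by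
    calc _ = w * u * (wᴴ * w) * v * wᴴ := by simp only [Matrix.mul_assoc]
      _ = _ := by rw [hV, Matrix.mul_one]; simp only [Matrix.mul_assoc]
  have e2 : w * u * wᴴ * (w * wᴴ) = w * u * wᴴ := by
    calc _ = w * u * (wᴴ * w) * wᴴ := by simp only [Matrix.mul_assoc]
      _ = _ := by rw [hV, Matrix.mul_one]
  have e3 : w * wᴴ * (w * v * wᴴ) = w * v * wᴴ := by
    calc _ = w * (wᴴ * w) * v * wᴴ := by simp only [Matrix.mul_assoc]
      _ = _ := by rw [hV, Matrix.mul_one]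
  have e4 : w * wᴴ * (w * wᴴ) = w * wᴴ := by
    calc _ = w * (wᴴ * w) * wᴴ := by simp only [Matrix.mul_assoc]
      _ = _ := by rw [hV, Matrix.mul_one]
  simp only [add_mul, mul_add, sub_mul, mul_sub, one_mul, mul_one, e1, e2, e3, e4]
  abel

theorem padMat_one {m n : ℕ} (h : m ≤ n) : padMat h (1 : Matrix (Fin m) (Fin m) R) = 1 := by
  simp [padMat]

theorem padMat_star {m n : ℕ} (h : m ≤ n) (u : Matrix (Fin m) (Fin m) R) :
    padMat h (star u) = star (padMat h u) := by
  simp [padMat, Matrix.star_eq_conjTranspose, Matrix.conjTranspose_mul, Matrix.mul_assoc]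

theorem padMat_self {n : ℕ} (u : Matrix (Fin n) (Fin n) R) : padMat le_rfl u = u := by
  simp [padMat, colMat_self]

theorem padMat_padMat {l m n : ℕ} (h : l ≤ m) (h' : m ≤ n) (u : Matrix (Fin l) (Fin l) R) :
    padMat h' (padMat h u) = padMat (h.trans h') u := by
  simp only [padMat, ← colMat_mul h h', Matrix.conjTranspose_mul, Matrix.mul_add, Matrix.add_mul,
    Matrix.mul_sub, Matrix.sub_mul, Matrix.mul_assoc, Matrix.mul_one]
  abel

theorem padMat_continuous {m n : ℕ} (h : m ≤ n) :
    Continuous fun u : Matrix (Fin m) (Fin m) R => padMat h u := by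
  unfold padMat
  fun_prop

/-- The connecting homomorphism `U_m(R) → U_n(R)`, `u ↦ diag(u, 1)`. -/
def U.pad {m n : ℕ} (h : m ≤ n) : U R m →* U R n where
  toFun u := ⟨padMat h u, by
    rw [Unitary.mem_iff, ← padMat_star, ← padMat_mul, ← padMat_mul]
    simp [padMat_one]⟩
  map_one' := Subtype.ext (padMat_one h)
  map_mul' u v := Subtype.ext (padMat_mul h (u : Matrix (Fin m) (Fin m) R) v)

theorem U.pad_continuous {m n : ℕ} (h : m ≤ n) : Continuous (U.pad h : U R m →* U R n) :=
  Continuous.subtype_mk ((padMat_continuous h).comp continuous_subtype_val) _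

/-- Entrywise application of a unital ⋆-homomorphism. -/
def U.map (f : R →⋆ₐ[ℂ] S) (n : ℕ) : U R n →* U S n where
  toFun u := ⟨(u : Matrix (Fin n) (Fin n) R).map f, by
    have h1 := congrArg (fun m => m.map f) (Unitary.coe_star_mul_self u)
    have h2 := congrArg (fun m => m.map f) (Unitary.coe_mul_star_self u)
    rw [Unitary.coe_star] at h2
    rw [Matrix.map_mul, Matrix.star_eq_conjTranspose, Matrix.conjTranspose_map f (map_star f)]
      at h1 h2
    rw [Unitary.mem_iff, Matrix.star_eq_conjTranspose]
    exact ⟨by simpa using h1, by simpa using h2⟩⟩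
  map_one' := Subtype.ext (by simp)
  map_mul' u v := Subtype.ext (by simp [Matrix.map_mul])

theorem U.map_continuous (f : R →⋆ₐ[ℂ] S) (n : ℕ) : Continuous (U.map f n) :=
  (continuous_subtype_val.matrix_map (AddMonoidHomClass.continuous_of_bound f 1 fun x => by
    simpa using NonUnitalStarAlgHom.norm_apply_le f x)).subtype_mk _

theorem U.map_pad (f : R →⋆ₐ[ℂ] S) {m n : ℕ} (h : m ≤ n) (u : U R m) :
    U.map f n (U.pad h u) = U.pad h (U.map f m u) := by
  apply Subtype.ext
  have hc : (colMat R h).map f = colMat S h := by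
    ext i j
    simp [colMat, apply_ite f]
  have hc' : ((colMat R h)ᴴ).map f = (colMat S h)ᴴ := by
    rw [Matrix.conjTranspose_map f (map_star f), hc]
  simp [U.map, U.pad, padMat, Matrix.map_mul, Matrix.map_add, Matrix.map_sub, hc, hc']

variable (R) in
/-- The normal subgroup `U_n(R)_0` of all unitaries that are homotopic to `1`, that is, connected
to `1` by a norm-continuous path of unitaries. -/
def U.nullHomotopic (n : ℕ) : Subgroup (U R n) where
  carrier := {u | Joined 1 u}
  one_mem' := Joined.refl 1
  mul_mem' {u v} hu hv := by
    obtain ⟨γ⟩ := hu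
    obtain ⟨δ⟩ := hv
    exact ⟨(γ.mul δ).cast (by simp) rfl⟩
  inv_mem' {u} hu := by
    obtain ⟨γ⟩ := hu
    exact ⟨(γ.map (f := fun u => star u) (by fun_prop)).cast (by simp) rfl⟩

instance (n : ℕ) : (U.nullHomotopic R n).Normal where
  conj_mem u hu v := by
    obtain ⟨γ⟩ := hu
    exact ⟨(γ.map (f := fun u => v * u * v⁻¹) (by fun_prop)).cast (by simp) rfl⟩

variable (R) in
/-- The group `U_n(R) / U_n(R)_0` of homotopy classes of unitaries. -/
abbrev piZeroU (n : ℕ) : Type _ := U R n ⧸ U.nullHomotopic R n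

/-- The homomorphism induced by `u ↦ diag(u, 1)`. -/
def piZeroU.pad (m n : ℕ) (h : m ≤ n) : piZeroU R m →* piZeroU R n :=
  QuotientGroup.map _ _ (U.pad h) fun _ ⟨γ⟩ =>
    ⟨(γ.map (U.pad_continuous h)).cast (map_one _).symm rfl⟩

/-- The homomorphism induced by a unital ⋆-homomorphism. -/
def piZeroU.map (f : R →⋆ₐ[ℂ] S) (n : ℕ) : piZeroU R n →* piZeroU S n :=
  QuotientGroup.map _ _ (U.map f n) fun _ ⟨γ⟩ =>
    ⟨(γ.map (U.map_continuous f n)).cast (map_one _).symm rfl⟩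

instance : DirectedSystem (piZeroU R) (piZeroU.pad (R := R) · · ·) where
  map_self _ x := by
    induction x using QuotientGroup.induction_on with | _ u
    exact congrArg _ (Subtype.ext (padMat_self _))
  map_map _ _ _ h h' x := by
    induction x using QuotientGroup.induction_on with | _ u
    exact congrArg _ (Subtype.ext (padMat_padMat h h' _))

variable (R) in
/-- The group `U_∞(R) / U_∞(R)_0 = lim U_n(R) / U_n(R)_0`, for a unital algebra `R`. -/
abbrev K₁₁ : Type _ := DirectLimit (piZeroU R) (piZeroU.pad (R := R))

/-- The homomorphism `K₁₁(R) → K₁₁(S)` induced by a unital ⋆-homomorphism. -/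
noncomputable def K₁₁.map (f : R →⋆ₐ[ℂ] S) : K₁₁ R →* K₁₁ S :=
  MonoidHom.mk' (DirectLimit.map _ _ (fun n => piZeroU.map f n) fun m n h x => by
    induction x using QuotientGroup.induction_on with | _ u
    exact congrArg _ (U.map_pad f h u).symm) fun x y => by
    induction x, y using DirectLimit.induction₂ with | _ n u v
    rw [DirectLimit.mul_def, DirectLimit.map_def, DirectLimit.map_def, DirectLimit.map_def,
      DirectLimit.mul_def, map_mul]

/-- The group `K₁(A) = U_∞(A⁺) / U_∞(A⁺)_0` of a C⋆-algebra `A`, unital or not. The group law is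
written multiplicatively. -/
def K₁ (A : Type*) [NonUnitalCStarAlgebra A] : Type _ := K₁₁ (Unitization ℂ A)

noncomputable instance (A : Type*) [NonUnitalCStarAlgebra A] : Group (K₁ A) :=
  inferInstanceAs (Group (K₁₁ (Unitization ℂ A)))

/-- The homomorphism `f_* : K₁(A) → K₁(B)` induced by a ⋆-homomorphism `f : A → B`. -/
noncomputable def K₁.map {A B : Type*} [NonUnitalCStarAlgebra A] [NonUnitalCStarAlgebra B]
    (f : A →⋆ₙₐ[ℂ] B) : K₁ A →* K₁ B :=
  K₁₁.map (Unitization.starMap f)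

end KOne

end KTheory

namespace CrossedProd
set_option linter.unusedSectionVars false

open MeasureTheory Topology KTheory
open scoped ENNReal ComplexOrder

universe u v

section UniversalRep

variable (A : Type u) [CStarAlgebra A] [PartialOrder A] [StarOrderedRing A]

/-- The Hilbert space of the universal representation of `A`: the Hilbert sum of the GNS spaces of
all positive functionals on `A`. -/
def HilbU : Type u := lp (fun f : A →ₚ[ℂ] ℂ => f.GNS) 2

noncomputable instance : NormedAddCommGroup (HilbU A) :=
  inferInstanceAs (NormedAddCommGroup (lp (fun f : A →ₚ[ℂ] ℂ => f.GNS) 2))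

noncomputable instance : InnerProductSpace ℂ (HilbU A) :=
  inferInstanceAs (InnerProductSpace ℂ (lp (fun f : A →ₚ[ℂ] ℂ => f.GNS) 2))

instance : CompleteSpace (HilbU A) :=
  inferInstanceAs (CompleteSpace (lp (fun f : A →ₚ[ℂ] ℂ => f.GNS) 2))

variable {A}

theorem memℓp_gns (a : A) (x : lp (fun f : A →ₚ[ℂ] ℂ => f.GNS) 2) :
    Memℓp (fun f : A →ₚ[ℂ] ℂ => f.gnsStarAlgHom a (x f)) 2 := by
  have hx := (memℓp_gen_iff (p := 2) (by norm_num)).1 (lp.memℓp x)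
  refine memℓp_gen (Summable.of_nonneg_of_le (fun _ => by positivity) (fun f => ?_)
    (hx.mul_left (‖a‖ ^ (2 : ℝ≥0∞).toReal)))
  rw [← Real.mul_rpow (norm_nonneg _) (norm_nonneg _)]
  refine Real.rpow_le_rpow (norm_nonneg _) ?_ (by norm_num)
  refine (ContinuousLinearMap.le_opNorm _ _).trans ?_
  gcongr
  exact NonUnitalStarAlgHom.norm_apply_le _ a

/-- The action of `a` on the Hilbert sum: `(a x)_f = π_f(a) x_f`. -/
noncomputable def univRepFun (a : A) :
    lp (fun f : A →ₚ[ℂ] ℂ => f.GNS) 2 →L[ℂ] lp (fun f : A →ₚ[ℂ] ℂ => f.GNS) 2 :=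
  LinearMap.mkContinuous
    { toFun := fun x => ⟨fun f => f.gnsStarAlgHom a (x f), memℓp_gns a x⟩
      map_add' := fun x y => by ext f; exact map_add (f.gnsStarAlgHom a) (x f) (y f)
      map_smul' := fun c x => by ext f; simp } ‖a‖ fun x => by
    rw [← sq_le_sq₀ (norm_nonneg _) (by positivity), mul_pow]
    have h2 : (2 : ℝ≥0∞).toReal = 2 := rfl
    have e := fun y : lp (fun f : A →ₚ[ℂ] ℂ => f.GNS) 2 =>
      lp.norm_rpow_eq_tsum (p := 2) (by norm_num) y
    simp only [h2, Real.rpow_ofNat] at e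
    rw [e, e, ← tsum_mul_left]
    have hx := (memℓp_gen_iff (p := 2) (by norm_num)).1 (lp.memℓp x)
    have hx' := (memℓp_gen_iff (p := 2) (by norm_num)).1 (memℓp_gns a x)
    simp only [h2, Real.rpow_ofNat] at hx hx'
    refine hx'.tsum_le_tsum (fun f => ?_) (hx.mul_left _)
    rw [← mul_pow]
    refine pow_le_pow_left₀ (norm_nonneg _) ?_ 2
    refine (ContinuousLinearMap.le_opNorm _ _).trans ?_
    gcongr
    exact NonUnitalStarAlgHom.norm_apply_le _ a

theorem univRepFun_apply (a : A) (x : lp (fun f : A →ₚ[ℂ] ℂ => f.GNS) 2) (f : A →ₚ[ℂ] ℂ) :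
    univRepFun a x f = f.gnsStarAlgHom a (x f) := rfl

variable (A) in
/-- The Hilbert sum of the GNS representations. -/
noncomputable def univRepLp : A →⋆ₐ[ℂ] (lp (fun f : A →ₚ[ℂ] ℂ => f.GNS) 2 →L[ℂ]
    lp (fun f : A →ₚ[ℂ] ℂ => f.GNS) 2) where
  toFun := univRepFun
  map_one' := by ext x f; simp [univRepFun_apply]
  map_mul' a b := by
    ext x f
    rw [mul_apply_eq_comp, univRepFun_apply, univRepFun_apply, univRepFun_apply, map_mul,
      mul_apply_eq_comp]
  map_zero' := by
    ext x f
    rw [univRepFun_apply, map_zero]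
    rfl
  map_add' a b := by
    ext x f
    rw [univRepFun_apply, map_add]
    rfl
  commutes' r := by
    ext x f
    rw [univRepFun_apply, AlgHomClass.commutes]
    rfl
  map_star' a := by
    rw [ContinuousLinearMap.star_eq_adjoint, ContinuousLinearMap.eq_adjoint_iff]
    intro x y
    rw [lp.inner_eq_tsum, lp.inner_eq_tsum]
    congr with f
    rw [univRepFun_apply, univRepFun_apply, map_star, ContinuousLinearMap.star_eq_adjoint,
      ContinuousLinearMap.adjoint_inner_left]

variable (A) in
/-- The universal representation of `A`: the Hilbert sum of the GNS representations of all
positive functionals on `A`. -/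
noncomputable def univRep : A →⋆ₐ[ℂ] (HilbU A →L[ℂ] HilbU A) := univRepLp A

end UniversalRep

section LTwo

variable (G : Type v) [CommGroup G] [TopologicalSpace G] [IsTopologicalGroup G] [CompactSpace G]
  [T2Space G] [MeasurableSpace G] [BorelSpace G]

/-- The normalized Haar measure of a compact group. -/
noncomputable def haarProb : Measure G := Measure.haarMeasure ⊤

instance : (haarProb G).IsHaarMeasure := by unfold haarProb; infer_instance
instance : (haarProb G).Regular := by unfold haarProb; infer_instance
instance : IsProbabilityMeasure (haarProb G) :=
  ⟨by simpa [haarProb] using Measure.haarMeasure_self (K₀ := (⊤ : TopologicalSpace.PositiveCompacts G))⟩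

/-- The Hilbert space `L²(G, H)`. -/
abbrev L2 (H : Type*) [NormedAddCommGroup H] : Type _ := Lp H 2 (haarProb G)


variable {G}
variable {H : Type*} [NormedAddCommGroup H] [InnerProductSpace ℂ H] [CompleteSpace H]

theorem stronglyMeasurable_of_compact {E : Type*} [NormedAddCommGroup E] (f : C(G, E)) :
    StronglyMeasurable f :=
  f.continuous.stronglyMeasurable_of_hasCompactSupport (HasCompactSupport.of_compactSpace f)

theorem memLp_cont (f : C(G, H)) : MemLp f 2 (haarProb G) :=
  MemLp.of_bound (stronglyMeasurable_of_compact f).aestronglyMeasurable ‖f‖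
    (Filter.Eventually.of_forall f.norm_coe_le_norm)

/-- The inclusion `C(G, H) → L²(G, H)`. -/
noncomputable def toL2 : C(G, H) →L[ℂ] L2 G H :=
  LinearMap.mkContinuous
    { toFun := fun f => (memLp_cont f).toLp f
      map_add' := fun _ _ => rfl
      map_smul' := fun _ _ => rfl } 1 fun f => by
    refine (Lp.norm_le_of_ae_bound (C := ‖f‖) (norm_nonneg _) ?_).trans ?_
    · filter_upwards [(memLp_cont f).coeFn_toLp] with s hs
      exact hs ▸ f.norm_coe_le_norm s
    · simp [measureUnivNNReal]

theorem toL2_coe (f : C(G, H)) : toL2 f =ᵐ[haarProb G] f := (memLp_cont f).coeFn_toLp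

theorem norm_toL2_le (f : C(G, H)) : ‖toL2 f‖ ≤ ‖f‖ := by
  simpa using (toL2 (G := G) (H := H)).le_of_opNorm_le
    (LinearMap.mkContinuous_norm_le _ zero_le_one _) f

theorem integrable_L2 (ξ : L2 G H) : Integrable ξ (haarProb G) :=
  (Lp.memLp ξ).integrable (by norm_num)

theorem integral_norm_le (ξ : L2 G H) : ∫ t, ‖ξ t‖ ∂haarProb G ≤ ‖ξ‖ := by
  rw [integral_norm_eq_lintegral_enorm (Lp.aestronglyMeasurable ξ), ← eLpNorm_one_eq_lintegral_enorm,
    Lp.norm_def]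
  exact ENNReal.toReal_mono (Lp.eLpNorm_ne_top ξ)
    (eLpNorm_le_eLpNorm_of_exponent_le (by norm_num) (Lp.aestronglyMeasurable ξ))

variable {A : Type u} [CStarAlgebra A] (ρ : A →⋆ₐ[ℂ] (H →L[ℂ] H))

theorem rep_continuous : Continuous ρ :=
  AddMonoidHomClass.continuous_of_bound ρ 1 fun x => by
    simpa using NonUnitalStarAlgHom.norm_apply_le ρ x

theorem norm_rep_le (k : C(G, A)) (t : G) (h : H) : ‖ρ (k t) h‖ ≤ ‖k‖ * ‖h‖ := by
  refine (ContinuousLinearMap.le_opNorm _ _).trans ?_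
  gcongr
  exact (NonUnitalStarAlgHom.norm_apply_le ρ _).trans (k.norm_coe_le_norm t)

theorem integrable_rep (k : C(G, A)) (ξ : L2 G H) :
    Integrable (fun t => ρ (k t) (ξ t)) (haarProb G) := by
  refine ((integrable_L2 ξ).norm.const_mul ‖k‖).mono' ?_
    (Filter.Eventually.of_forall fun t => norm_rep_le ρ k t _)
  have h1 : StronglyMeasurable fun t => ρ (k t) :=
    stronglyMeasurable_of_compact ⟨fun t => ρ (k t), (rep_continuous ρ).comp k.continuous⟩
  exact (ContinuousLinearMap.id ℂ (H →L[ℂ] H)).aestronglyMeasurable_comp₂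
    h1.aestronglyMeasurable (Lp.aestronglyMeasurable ξ)

theorem norm_integral_rep_le (k : C(G, A)) (ξ : L2 G H) :
    ‖∫ t, ρ (k t) (ξ t) ∂haarProb G‖ ≤ ‖k‖ * ‖ξ‖ := by
  refine (norm_integral_le_of_norm_le ((integrable_L2 ξ).norm.const_mul ‖k‖)
    (Filter.Eventually.of_forall fun t => norm_rep_le ρ k t _)).trans ?_
  rw [integral_const_mul]
  gcongr
  exact integral_norm_le ξ

/-- The continuous function `s ↦ ∫ ρ(K(s, t)) ξ(t) dt`. -/
noncomputable def kernelFun (K : C(G × G, A)) (ξ : L2 G H) : C(G, H) where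
  toFun s := ∫ t, ρ (K (s, t)) (ξ t) ∂haarProb G
  continuous_toFun := by
    rw [continuous_iff_continuousAt]
    intro s₀
    rw [ContinuousAt, tendsto_iff_norm_sub_tendsto_zero]
    have hK : Filter.Tendsto (fun s => ‖K.curry s - K.curry s₀‖ * ‖ξ‖) (𝓝 s₀) (𝓝 0) := by
      have h : Continuous fun s => ‖K.curry s - K.curry s₀‖ * ‖ξ‖ := by fun_prop
      simpa using h.tendsto s₀
    refine squeeze_zero (fun _ => norm_nonneg _) (fun s => ?_) hK
    have := norm_integral_rep_le ρ (K.curry s - K.curry s₀) ξ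
    have e := integral_sub (integrable_rep ρ (K.curry s) ξ) (integrable_rep ρ (K.curry s₀) ξ)
    simp only [ContinuousMap.sub_apply, ContinuousMap.curry_apply, map_sub, sub_apply] at this e
    rwa [e] at this

theorem norm_kernelFun_le (K : C(G × G, A)) (ξ : L2 G H) : ‖kernelFun ρ K ξ‖ ≤ ‖K‖ * ‖ξ‖ := by
  refine (ContinuousMap.norm_le _ (by positivity)).2 fun s => ?_
  refine (norm_integral_rep_le ρ (K.curry s) ξ).trans ?_
  gcongr
  exact (ContinuousMap.norm_le _ (norm_nonneg _)).2 fun t => K.norm_coe_le_norm (s, t)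

/-- The integral operator `(T_K ξ)(s) = ∫ ρ(K(s, t)) ξ(t) dt` on `L²(G, H)`, for a continuous
kernel `K : G × G → A` and a representation `ρ` of `A` on `H`; as a function of `K`. -/
noncomputable def kernelOp : C(G × G, A) →L[ℂ] (L2 G H →L[ℂ] L2 G H) :=
  LinearMap.mkContinuous₂
    (LinearMap.mk₂ ℂ (fun K ξ => toL2 (kernelFun ρ K ξ))
      (fun K L ξ => by
        rw [← map_add]
        congr 1
        ext s
        simpa [kernelFun] using
          integral_add (integrable_rep ρ (K.curry s) ξ) (integrable_rep ρ (L.curry s) ξ))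
      (fun c K ξ => by
        rw [← map_smul]
        congr 1
        ext s
        simp [kernelFun, integral_smul])
      (fun K ξ η => by
        rw [← map_add]
        congr 1
        ext s
        have h1 := integral_add (integrable_rep ρ (K.curry s) ξ) (integrable_rep ρ (K.curry s) η)
        simp only [ContinuousMap.curry_apply, ← map_add] at h1
        simp only [kernelFun, ContinuousMap.coe_mk, ContinuousMap.add_apply]
        rw [← h1]
        refine integral_congr_ae ?_
        filter_upwards [Lp.coeFn_add ξ η] with t ht
        rw [ht, Pi.add_apply])
      (fun c K ξ => by
        rw [← map_smul]
        congr 1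
        ext s
        simp only [kernelFun, ContinuousMap.coe_mk, ContinuousMap.smul_apply]
        rw [← integral_smul]
        refine integral_congr_ae ?_
        filter_upwards [Lp.coeFn_smul c ξ] with t ht
        rw [ht, Pi.smul_apply, map_smul]))
    1 fun K ξ => by
      rw [one_mul]
      exact (norm_toL2_le _).trans (norm_kernelFun_le ρ K ξ)

theorem kernelOp_apply (K : C(G × G, A)) (ξ : L2 G H) :
    kernelOp ρ K ξ = toL2 (kernelFun ρ K ξ) := rfl

theorem kernelOp_coe (K : C(G × G, A)) (ξ : L2 G H) :
    kernelOp ρ K ξ =ᵐ[haarProb G] fun s => ∫ t, ρ (K (s, t)) (ξ t) ∂haarProb G :=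
  toL2_coe (kernelFun ρ K ξ)

/-- The elementary vector `f ⊗ h` of `L²(G, H) = L²(G) ⊗ H`, that is, the function
`s ↦ f(s) h`. -/
noncomputable def tensorVec (f : L2 G ℂ) (h : H) : L2 G H :=
  (ContinuousLinearMap.toSpanSingleton ℂ h).compLp f

theorem tensorVec_coe (f : L2 G ℂ) (h : H) :
    tensorVec f h =ᵐ[haarProb G] fun s => f s • h := by
  filter_upwards [(ContinuousLinearMap.toSpanSingleton ℂ h).coeFn_compLp f] with s hs
  exact hs

/-- `T` is the elementary tensor `a ⊗ k`: it maps `f ⊗ h` to `k(f) ⊗ ρ(a)h`. -/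
def IsElementaryTensor (a : A) (k : L2 G ℂ →L[ℂ] L2 G ℂ) (T : L2 G H →L[ℂ] L2 G H) : Prop :=
  ∀ (f : L2 G ℂ) (h : H), T (tensorVec f h) = tensorVec (k f) (ρ a h)

variable (G) in
/-- The C⋆-algebra `ρ(A) ⊗ 𝒦(L²(G))` on `L²(G, H) = L²(G) ⊗ H`: the closed ⋆-algebra generated by
the elementary tensors `a ⊗ k`, with `a ∈ A` and `k` a compact operator on `L²(G)`. -/
noncomputable def tensorCompactsOf : NonUnitalStarSubalgebra ℂ (L2 G H →L[ℂ] L2 G H) :=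
  (NonUnitalStarAlgebra.adjoin ℂ {T | ∃ (a : A) (k : L2 G ℂ →L[ℂ] L2 G ℂ),
    IsCompactOperator k ∧ IsElementaryTensor ρ a k T}).topologicalClosure

theorem exists_finite_approx {X E : Type*} [TopologicalSpace X] [CompactSpace X] [T2Space X]
    [NormedAddCommGroup E] [NormedSpace ℂ E] (F : C(X, E)) {ε : ℝ} (hε : 0 < ε) :
    ∃ (t : Finset X) (f : X → C(X, ℂ)), ∀ x, ‖F x - ∑ y ∈ t, f y x • F y‖ ≤ ε := by
  obtain ⟨t, ht⟩ := isCompact_univ.elim_finite_subcover (fun y : X => {x | ‖F x - F y‖ < ε})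
    (fun y => isOpen_lt (by fun_prop) continuous_const)
    (fun x _ => Set.mem_iUnion.2 ⟨x, by simpa using hε⟩)
  obtain ⟨p, hp⟩ := PartitionOfUnity.exists_isSubordinate (ι := t) (s := Set.univ) isClosed_univ
    (fun y => {x | ‖F x - F y‖ < ε}) (fun y => isOpen_lt (by fun_prop) continuous_const)
    (fun x hx => by simpa using ht hx)
  classical
  refine ⟨t, fun y => if h : y ∈ t then ⟨fun x => (p ⟨y, h⟩ x : ℂ), by fun_prop⟩ else 0,
    fun x => ?_⟩
  have h1 : ∑ y : t, p y x = 1 := by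
    rw [← finsum_eq_sum_of_fintype]
    exact p.sum_eq_one (Set.mem_univ x)
  have h2 : F x - ∑ y ∈ t, (if h : y ∈ t then
      (⟨fun x => (p ⟨y, h⟩ x : ℂ), by fun_prop⟩ : C(X, ℂ)) else 0) x • F y =
      ∑ y : t, (p y x : ℂ) • (F x - F y) := by
    simp only [smul_sub, Finset.sum_sub_distrib, ← Finset.sum_smul]
    congr 1
    · rw [← Complex.ofReal_sum, h1, Complex.ofReal_one, one_smul]
    · rw [← Finset.sum_coe_sort t]
      exact Finset.sum_congr rfl fun y _ => by simp
  rw [h2]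
  calc ‖∑ y : t, (p y x : ℂ) • (F x - F y)‖ ≤ ∑ y : t, p y x * ε := by
        refine norm_sum_le_of_le _ fun y _ => ?_
        rw [norm_smul, Complex.norm_real, Real.norm_of_nonneg (p.nonneg y x)]
        by_cases hy : p y x = 0
        · simp [hy]
        · have : x ∈ {x | ‖F x - F y‖ < ε} := hp y (subset_tsupport _ hy)
          exact mul_le_mul_of_nonneg_left (le_of_lt this) (p.nonneg y x)
    _ = ε := by rw [← Finset.sum_mul, h1, one_mul]

/-- The kernel `f(s) k(t)`. -/
noncomputable def prodKernel (f : C(G, ℂ)) (k : C(G, A)) : C(G × G, A) :=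
  ⟨fun p => f p.1 • k p.2, by fun_prop⟩

theorem kernelOp_prod_mem (f g : C(G, ℂ)) (a : A) :
    kernelOp ρ (prodKernel f ⟨fun t => g t • a, by fun_prop⟩) ∈
      tensorCompactsOf G ρ := by
  refine NonUnitalStarSubalgebra.le_topologicalClosure _ (NonUnitalStarAlgebra.subset_adjoin ℂ _ ?_)
  refine ⟨a, (ContinuousLinearMap.toSpanSingleton ℂ (toL2 f)) ∘L (innerSL ℂ (toL2 (star g))), ?_,
    fun ξ h => ?_⟩
  · exact (isCompactOperator_of_locallyCompactSpace_rng
      (ContinuousLinearMap.toSpanSingleton ℂ (toL2 f))).comp_clm (innerSL ℂ (toL2 (star g)))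
  · have e : innerSL ℂ (toL2 (star g)) ξ = ∫ t, g t * ξ t ∂haarProb G := by
      rw [innerSL_apply_apply, L2.inner_def]
      refine integral_congr_ae ?_
      filter_upwards [toL2_coe (star g)] with t ht
      rw [ht]
      simp [mul_comm]
    rw [ContinuousLinearMap.comp_apply, e, ContinuousLinearMap.toSpanSingleton_apply]
    apply Lp.ext
    have hint : Integrable (fun t => g t * ξ t) (haarProb G) := by
      have := integrable_rep (StarAlgHom.ofId ℂ (ℂ →L[ℂ] ℂ)) g ξ
      simpa [Algebra.algebraMap_eq_smul_one] using this
    filter_upwards [kernelOp_coe ρ (prodKernel f ⟨fun t => g t • a, by fun_prop⟩) (tensorVec ξ h),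
      tensorVec_coe ((∫ t, g t * ξ t ∂haarProb G) • toL2 f) (ρ a h),
      Lp.coeFn_smul (∫ t, g t * ξ t ∂haarProb G) (toL2 f), toL2_coe f] with s h1 h2 h3 h4
    rw [h1, h2, h3, Pi.smul_apply, h4]
    have : ∀ᵐ t ∂haarProb G, ρ (prodKernel f ⟨fun t => g t • a, by fun_prop⟩ (s, t))
        (tensorVec ξ h t) = (g t * ξ t) • (f s • ρ a h) := by
      filter_upwards [tensorVec_coe ξ h] with t ht
      rw [ht]
      simp only [prodKernel, ContinuousMap.coe_mk, map_smul, smul_apply, smul_smul]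
      congr 1
      ring
    rw [integral_congr_ae this, integral_smul_const, smul_smul, smul_eq_mul]

/-- Every integral operator with continuous kernel lies in `ρ(A) ⊗ 𝒦(L²(G))`. -/
theorem kernelOp_mem (K : C(G × G, A)) :
    kernelOp ρ K ∈ tensorCompactsOf G ρ := by
  have hcl : IsClosed {K : C(G × G, A) | kernelOp ρ K ∈
      tensorCompactsOf G ρ} :=
    (NonUnitalStarSubalgebra.isClosed_topologicalClosure _).preimage (kernelOp ρ).continuous
  have h1 (f : C(G, ℂ)) (k : C(G, A)) : kernelOp ρ (prodKernel f k) ∈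
      tensorCompactsOf G ρ := by
    refine hcl.closure_subset (Metric.mem_closure_iff.2 fun ε hε => ?_)
    obtain ⟨t, g, hg⟩ := exists_finite_approx k (ε := ε / (2 * (‖f‖ + 1))) (by positivity)
    refine ⟨∑ y ∈ t, prodKernel f ⟨fun s => g y s • k y, by fun_prop⟩, ?_, ?_⟩
    · rw [Set.mem_ofPred_eq, map_sum]
      exact sum_mem fun y _ => kernelOp_prod_mem ρ f (g y) (k y)
    · rw [dist_eq_norm]
      refine lt_of_le_of_lt ((ContinuousMap.norm_le _ (C := ε / 2) (by positivity)).2 ?_)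
        (half_lt_self hε)
      rintro ⟨s, x⟩
      have := hg x
      simp only [prodKernel, ContinuousMap.sub_apply, ContinuousMap.coe_mk, ContinuousMap.coe_sum,
        Finset.sum_apply, ← Finset.smul_sum, ← smul_sub]
      rw [norm_smul]
      calc _ ≤ (‖f‖ + 1) * (ε / (2 * (‖f‖ + 1))) := by
            gcongr
            linarith [f.norm_coe_le_norm s]
        _ = ε / 2 := by field_simp
  refine hcl.closure_subset (Metric.mem_closure_iff.2 fun ε hε => ?_)
  obtain ⟨t, g, hg⟩ := exists_finite_approx K.curry (ε := ε / 2) (by positivity)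
  refine ⟨∑ y ∈ t, prodKernel (g y) (K.curry y), ?_, ?_⟩
  · rw [Set.mem_ofPred_eq, map_sum]
    exact sum_mem fun y _ => h1 (g y) (K.curry y)
  · rw [dist_eq_norm]
    refine lt_of_le_of_lt ((ContinuousMap.norm_le _ (C := ε / 2) (by positivity)).2 ?_)
      (half_lt_self hε)
    rintro ⟨s, x⟩
    refine le_trans ?_ (((K.curry s - ∑ y ∈ t, g y s • K.curry y).norm_coe_le_norm x).trans (hg s))
    simp [prodKernel]

/-- The isometry `H → L²(G, H)` that sends `h` to the constant function `h`. -/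
noncomputable def constVec : H →L[ℂ] L2 G H :=
  LinearMap.mkContinuous
    { toFun := fun h => toL2 (ContinuousMap.const G h)
      map_add' := fun x y => by rw [← map_add]; rfl
      map_smul' := fun c x => by rw [← map_smul]; rfl } 1 fun h => by
    rw [one_mul]
    exact (norm_toL2_le _).trans ((ContinuousMap.norm_le _ (norm_nonneg _)).2 fun _ => le_rfl)

theorem constVec_apply (h : H) : (constVec h : L2 G H) = toL2 (ContinuousMap.const G h) := rfl

theorem adjoint_constVec (ξ : L2 G H) :
    ContinuousLinearMap.adjoint (constVec : H →L[ℂ] L2 G H) ξ = ∫ t, ξ t ∂haarProb G := by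
  refine ext_inner_left ℂ fun h => ?_
  rw [ContinuousLinearMap.adjoint_inner_right, L2.inner_def, ← integral_inner (integrable_L2 ξ)]
  refine integral_congr_ae ?_
  filter_upwards [toL2_coe (ContinuousMap.const G h)] with t ht
  rw [constVec_apply, ht]
  rfl

theorem adjoint_constVec_comp :
    ContinuousLinearMap.adjoint (constVec : H →L[ℂ] L2 G H) ∘L constVec =
      ContinuousLinearMap.id ℂ H := by
  ext h
  rw [ContinuousLinearMap.comp_apply, adjoint_constVec, constVec_apply,
    integral_congr_ae (toL2_coe (ContinuousMap.const G h))]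
  simp

theorem kernelOp_const (a : A) : (kernelOp ρ (ContinuousMap.const (G × G) a) : L2 G H →L[ℂ] L2 G H) =
    constVec ∘L ρ a ∘L ContinuousLinearMap.adjoint constVec := by
  ext1 ξ
  rw [kernelOp_apply, ContinuousLinearMap.comp_apply, ContinuousLinearMap.comp_apply,
    adjoint_constVec, constVec_apply]
  congr 1
  ext s
  exact (ρ a).integral_comp_comm (integrable_L2 ξ)

/-- The corner embedding `a ↦ a ⊗ e` of `A` into `ρ(A) ⊗ 𝒦(L²(G))`, where `e` is the rank-one
projection of `L²(G)` onto the constant functions: `((a ⊗ e)ξ)(s) = ρ(a) ∫ ξ(t) dt`. -/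
noncomputable def cornerOf : A →⋆ₙₐ[ℂ]
    tensorCompactsOf G ρ :=
  NonUnitalStarAlgHom.codRestrict
    ({ toFun := fun a => constVec ∘L ρ a ∘L ContinuousLinearMap.adjoint constVec
       map_smul' := fun c a => by ext1 ξ; simp
       map_zero' := by ext1 ξ; simp
       map_add' := fun a b => by ext1 ξ; simp
       map_mul' := fun a b => by
         ext1 ξ
         have h := fun x => DFunLike.congr_fun (adjoint_constVec_comp (G := G) (H := H)) x
         simp only [ContinuousLinearMap.comp_apply, ContinuousLinearMap.id_apply] at h
         simp only [map_mul, mul_apply_eq_comp, ContinuousLinearMap.comp_apply, h]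
       map_star' := fun a => by
         simp only [map_star, ContinuousLinearMap.star_eq_adjoint, ContinuousLinearMap.adjoint_comp,
           ContinuousLinearMap.adjoint_adjoint, ContinuousLinearMap.comp_assoc] } :
      A →⋆ₙₐ[ℂ] (L2 G H →L[ℂ] L2 G H)) _ fun a => by
    have := kernelOp_mem ρ (ContinuousMap.const (G × G) a)
    rwa [kernelOp_const] at this

/-- The translation operator `(λ_t ξ)(s) = ξ(t⁻¹ s)`. -/
noncomputable def transl (t : G) : L2 G H →L[ℂ] L2 G H :=
  (Lp.compMeasurePreservingₗᵢ ℂ (t⁻¹ * ·)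
    (measurePreserving_mul_left (haarProb G) t⁻¹)).toContinuousLinearMap

theorem norm_char (χ : PontryaginDual G) (s : G) : ‖(χ s : ℂ)‖ = 1 := Circle.norm_coe (χ s)

theorem char_inv (χ : PontryaginDual G) (s : G) : (χ⁻¹ s : ℂ) * (χ s : ℂ) = 1 := by
  rw [← Circle.coe_mul]
  exact congrArg _ (inv_mul_cancel (χ s))

theorem memLp_char (χ : PontryaginDual G) (ξ : L2 G H) :
    MemLp (fun s => (χ s : ℂ) • ξ s) 2 (haarProb G) := by
  refine (Lp.memLp ξ).of_le ?_ (Filter.Eventually.of_forall fun s => by simp [norm_smul, norm_char])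
  exact (stronglyMeasurable_of_compact (⟨fun s => (χ s : ℂ),
    continuous_subtype_val.comp (map_continuous χ)⟩ : C(G, ℂ))).aestronglyMeasurable.smul
    (Lp.aestronglyMeasurable ξ)

/-- The unitary operator of multiplication by the character `χ`: `(v(χ)ξ)(s) = χ(s) ξ(s)`. -/
noncomputable def charMul (χ : PontryaginDual G) : L2 G H ≃ₗᵢ[ℂ] L2 G H :=
  have h1 (χ : PontryaginDual G) (ξ : L2 G H) := (memLp_char χ ξ).coeFn_toLp
  { toFun := fun ξ => (memLp_char χ ξ).toLp
    invFun := fun ξ => (memLp_char χ⁻¹ ξ).toLp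
    map_add' := fun ξ η => by
      apply Lp.ext
      filter_upwards [h1 χ (ξ + η), h1 χ ξ, h1 χ η, Lp.coeFn_add ξ η,
        Lp.coeFn_add ((memLp_char χ ξ).toLp) ((memLp_char χ η).toLp)] with s e1 e2 e3 e4 e5
      rw [e1, e5, Pi.add_apply, e2, e3, e4, Pi.add_apply, smul_add]
    map_smul' := fun c ξ => by
      apply Lp.ext
      filter_upwards [h1 χ (c • ξ), h1 χ ξ, Lp.coeFn_smul c ξ,
        Lp.coeFn_smul c ((memLp_char χ ξ).toLp)] with s e1 e2 e3 e4
      rw [e1, RingHom.id_apply, e4, Pi.smul_apply, e2, e3, Pi.smul_apply, smul_comm]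
    left_inv := fun ξ => by
      apply Lp.ext
      filter_upwards [h1 χ⁻¹ ((memLp_char χ ξ).toLp), h1 χ ξ] with s e1 e2
      rw [e1, e2, smul_smul, char_inv, one_smul]
    right_inv := fun ξ => by
      apply Lp.ext
      filter_upwards [h1 χ ((memLp_char χ⁻¹ ξ).toLp), h1 χ⁻¹ ξ] with s e1 e2
      rw [e1, e2, smul_smul, mul_comm, char_inv, one_smul]
    norm_map' := fun ξ => by
      change ‖(memLp_char χ ξ).toLp‖ = _
      rw [Lp.norm_toLp, Lp.norm_def]
      congr 1
      refine eLpNorm_congr_norm_ae (Filter.Eventually.of_forall fun s => ?_)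
      simp [norm_smul, norm_char] }

theorem charMul_coe (χ : PontryaginDual G) (ξ : L2 G H) :
    charMul χ ξ =ᵐ[haarProb G] fun s => (χ s : ℂ) • ξ s := (memLp_char χ ξ).coeFn_toLp

theorem charMul_symm (χ : PontryaginDual G) :
    (charMul χ : L2 G H ≃ₗᵢ[ℂ] L2 G H).symm = charMul χ⁻¹ := by
  ext1 ξ
  rfl

/-- The automorphism `Ad v(χ)` of the algebra of bounded operators. -/
noncomputable def adChar (χ : PontryaginDual G) :
    (L2 G H →L[ℂ] L2 G H) ≃⋆ₐ[ℂ] (L2 G H →L[ℂ] L2 G H) :=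
  (charMul χ).conjStarAlgEquiv

theorem adChar_apply (χ : PontryaginDual G) (T : L2 G H →L[ℂ] L2 G H) (ξ : L2 G H) :
    adChar χ T ξ = charMul χ (T (charMul χ⁻¹ ξ)) := by
  rw [← charMul_symm]
  rfl

end LTwo

section Actions

variable (G : Type v) [CommGroup G] [TopologicalSpace G] [IsTopologicalGroup G] [CompactSpace G]
  [T2Space G] [MeasurableSpace G] [BorelSpace G]
variable (A : Type u) [CStarAlgebra A]

/-- An action of a topological group on a C⋆-algebra: a homomorphism `t ↦ α_t` to the group of
⋆-automorphisms such that `t ↦ α_t(a)` is continuous for every `a`. -/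
structure CAction (G : Type v) [Group G] [TopologicalSpace G] (A : Type u) [CStarAlgebra A] where
  toAut : G →* (A ≃⋆ₐ[ℂ] A)
  continuous_orbit : ∀ a : A, Continuous fun t => toAut t a

/-- Conjugacy of actions: `α_t = σ β_t σ⁻¹` for an automorphism `σ` and all `t`. -/
def CAction.IsConj {G : Type v} [Group G] [TopologicalSpace G] {A : Type u} [CStarAlgebra A]
    (α β : CAction G A) : Prop :=
  ∃ σ : A ≃⋆ₐ[ℂ] A, ∀ t, α.toAut t = σ * β.toAut t * σ⁻¹

variable {G A} {H : Type*} [NormedAddCommGroup H] [InnerProductSpace ℂ H] [CompleteSpace H]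
variable (ρ : A →⋆ₐ[ℂ] (H →L[ℂ] H)) (α : CAction G A)

theorem CAction.continuous_uncurry : Continuous fun p : G × A => α.toAut p.1 p.2 := by
  rw [continuous_iff_continuousAt]
  rintro ⟨t₀, a₀⟩
  rw [ContinuousAt, tendsto_iff_norm_sub_tendsto_zero]
  have h1 : Filter.Tendsto (fun p : G × A => ‖p.2 - a₀‖ + ‖α.toAut p.1 a₀ - α.toAut t₀ a₀‖)
      (𝓝 (t₀, a₀)) (𝓝 0) := by
    have h : Continuous fun p : G × A => ‖p.2 - a₀‖ + ‖α.toAut p.1 a₀ - α.toAut t₀ a₀‖ := by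
      have := (α.continuous_orbit a₀).comp (continuous_fst (X := G) (Y := A))
      fun_prop
    simpa using h.tendsto (t₀, a₀)
  refine squeeze_zero (fun _ => norm_nonneg _) (fun p => ?_) h1
  calc ‖α.toAut p.1 p.2 - α.toAut t₀ a₀‖
      = ‖α.toAut p.1 (p.2 - a₀) + (α.toAut p.1 a₀ - α.toAut t₀ a₀)‖ := by
        rw [map_sub]
        congr 1
        abel
    _ ≤ _ := (norm_add_le _ _).trans (by rw [StarAlgEquiv.norm_map])

/-- The kernel `(s, r) ↦ α_s⁻¹(F(s r⁻¹))`. -/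
noncomputable def regKernel (F : C(G, A)) : C(G × G, A) :=
  ⟨fun p => α.toAut p.1⁻¹ (F (p.1 * p.2⁻¹)),
    α.continuous_uncurry.comp (by fun_prop : Continuous fun p : G × G =>
      (p.1⁻¹, F (p.1 * p.2⁻¹)))⟩

/-- The operator `(π_α × λ)(F) = ∫ π_α(F(t)) λ_t dt` on `L²(G, H)` for `F ∈ C(G, A)`, where
`(π_α(a)ξ)(s) = α_s⁻¹(a) ξ(s)` and `(λ_t ξ)(s) = ξ(t⁻¹ s)`; see `regOp_coe`. -/
noncomputable def regOp (F : C(G, A)) : L2 G H →L[ℂ] L2 G H :=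
  kernelOp ρ (regKernel α F)

theorem regOp_coe (F : C(G, A)) (ξ : L2 G H) :
    regOp ρ α F ξ =ᵐ[haarProb G]
      fun s => ∫ t, ρ (α.toAut s⁻¹ (F t)) (ξ (t⁻¹ * s)) ∂haarProb G := by
  filter_upwards [kernelOp_coe ρ (regKernel α F) ξ] with s hs
  rw [regOp, hs, ← integral_mul_right_eq_self _ s, ← integral_inv_eq_self]
  refine integral_congr_ae (Filter.Eventually.of_forall fun t => ?_)
  simp [regKernel]

/-- The crossed product `A ⋊_α G`: the closed ⋆-algebra generated by the operators
`∫ π_α(F(t)) λ_t dt`, `F ∈ C(G, A)`, of the regular representation induced by `ρ` on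
`L²(G, H)`. -/
noncomputable def crossedProductOf :
    NonUnitalStarSubalgebra ℂ (L2 G H →L[ℂ] L2 G H) :=
  (NonUnitalStarAlgebra.adjoin ℂ (Set.range (regOp ρ α))).topologicalClosure

instance : IsClosed (crossedProductOf ρ α : Set (L2 G H →L[ℂ] L2 G H)) :=
  NonUnitalStarSubalgebra.isClosed_topologicalClosure _

theorem regOp_mem (F : C(G, A)) : regOp ρ α F ∈ crossedProductOf ρ α :=
  NonUnitalStarSubalgebra.le_topologicalClosure _
    (NonUnitalStarAlgebra.subset_adjoin ℂ _ ⟨F, rfl⟩)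

theorem crossedProductOf_le_of {S : NonUnitalStarSubalgebra ℂ (L2 G H →L[ℂ] L2 G H)}
    (hS : IsClosed (S : Set (L2 G H →L[ℂ] L2 G H))) (h : ∀ F, regOp ρ α F ∈ S) :
    crossedProductOf ρ α ≤ S :=
  NonUnitalStarSubalgebra.topologicalClosure_minimal _
    (NonUnitalStarAlgebra.adjoin_le (Set.range_subset_iff.2 h)) hS

theorem crossedProductOf_le :
    crossedProductOf ρ α ≤ tensorCompactsOf G ρ :=
  crossedProductOf_le_of ρ α (NonUnitalStarSubalgebra.isClosed_topologicalClosure _)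
    fun _ => kernelOp_mem _ _

/-- The inclusion `ι : A ⋊_α G ⊆ A ⊗ 𝒦(L²(G))`. -/
noncomputable def inclOf : crossedProductOf ρ α →⋆ₙₐ[ℂ]
    tensorCompactsOf G ρ :=
  NonUnitalStarSubalgebra.inclusion (crossedProductOf_le ρ α)

/-- The function `t ↦ χ(t) F(t)`. -/
noncomputable def charSMul (χ : PontryaginDual G) (F : C(G, A)) : C(G, A) :=
  ⟨fun t => (χ t : ℂ) • F t,
    (continuous_subtype_val.comp (map_continuous χ)).smul F.continuous⟩

theorem adChar_regOp (χ : PontryaginDual G) (F : C(G, A)) :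
    adChar χ (regOp ρ α F) = regOp ρ α (charSMul χ F) := by
  ext1 ξ
  rw [adChar_apply]
  apply Lp.ext
  filter_upwards [charMul_coe χ (regOp ρ α F (charMul χ⁻¹ ξ)),
    kernelOp_coe ρ (regKernel α F) (charMul χ⁻¹ ξ),
    kernelOp_coe ρ (regKernel α (charSMul χ F)) ξ] with s h1 h2 h3
  rw [h1, regOp, h2, regOp, h3, ← integral_smul]
  refine integral_congr_ae ?_
  filter_upwards [charMul_coe χ⁻¹ ξ] with t ht
  have e : (χ (s * t⁻¹) : ℂ) = χ s * χ⁻¹ t := by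
    rw [map_mul, map_inv, Circle.coe_mul]
    rfl
  rw [ht]
  simp only [regKernel, charSMul, ContinuousMap.coe_mk, map_smul, smul_apply, smul_smul, e]

theorem adChar_mem (χ : PontryaginDual G) (x : crossedProductOf ρ α) :
    adChar χ (x : L2 G H →L[ℂ] L2 G H) ∈ crossedProductOf ρ α := by
  have hc : Continuous (adChar χ : (L2 G H →L[ℂ] L2 G H) → _) :=
    (StarAlgEquiv.isometry (adChar χ : (L2 G H →L[ℂ] L2 G H) ≃⋆ₐ[ℂ] _)).continuous
  have := crossedProductOf_le_of ρ α (S := (crossedProductOf ρ α).comap (adChar χ))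
    ((NonUnitalStarSubalgebra.isClosed_topologicalClosure _).preimage hc) fun F => by
      rw [NonUnitalStarSubalgebra.mem_comap, adChar_regOp]
      exact regOp_mem ρ α _
  exact this x.2

/-- The dual action `α̂_χ = Ad v(χ)` on `A ⋊_α G`, for `χ` in the dual group of `G`. On the
generators it is given by `F ↦ χF`, see `adChar_regOp`. -/
noncomputable def dualActionOf (χ : PontryaginDual G) :
    crossedProductOf ρ α →⋆ₙₐ[ℂ] crossedProductOf ρ α :=
  NonUnitalStarAlgHom.codRestrict ((NonUnitalStarAlgHomClass.toNonUnitalStarAlgHom (adChar χ) :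
      (L2 G H →L[ℂ] L2 G H) →⋆ₙₐ[ℂ] (L2 G H →L[ℂ] L2 G H)).comp
    (NonUnitalStarSubalgebraClass.subtype (crossedProductOf ρ α))) _ fun x => adChar_mem ρ α χ x

/-- The spectral projection `P_α(χ) = ∫ χ(t)⁻¹ λ_t dt ∈ A ⋊_α G` of the unitary representation `λ`,
for `χ` in the dual group of `G`; the projection `P_α(0)` is the one of the trivial character. -/
noncomputable def specProjOf (χ : PontryaginDual G) : crossedProductOf ρ α :=
  ⟨regOp ρ α (charSMul χ⁻¹ 1), regOp_mem ρ α _⟩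

theorem specProjOf_isStarProjection (χ : PontryaginDual G) : IsStarProjection (specProjOf ρ α χ) := by
  have h1 : regOp ρ α 1 = constVec ∘L ContinuousLinearMap.adjoint constVec := by
    have e : regKernel α 1 = ContinuousMap.const (G × G) 1 := by
      ext p
      simp [regKernel]
    rw [regOp, e, kernelOp_const, map_one]
    rfl
  have h2 : IsStarProjection (regOp ρ α 1) := by
    rw [h1]
    refine ⟨?_, ?_⟩
    · ext1 ξ
      have h := fun x => DFunLike.congr_fun (adjoint_constVec_comp (G := G) (H := H)) x
      simp only [ContinuousLinearMap.comp_apply, ContinuousLinearMap.id_apply] at h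
      simp only [mul_apply_eq_comp, ContinuousLinearMap.comp_apply, h]
    · rw [IsSelfAdjoint, ContinuousLinearMap.star_eq_adjoint, ContinuousLinearMap.adjoint_comp,
        ContinuousLinearMap.adjoint_adjoint]
  have h3 : IsStarProjection (regOp ρ α (charSMul χ⁻¹ 1)) := by
    rw [← adChar_regOp]
    exact h2.map (adChar χ⁻¹)
  exact ⟨Subtype.ext h3.isIdempotentElem, Subtype.ext h3.isSelfAdjoint⟩

/-- `P_α(χ)` is the spectral projection of `λ` at `χ`: `λ_t P_α(χ) = χ(t) P_α(χ)`. -/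
theorem transl_specProjOf (χ : PontryaginDual G) (t : G) (ξ : L2 G H) :
    transl t ((specProjOf ρ α χ : L2 G H →L[ℂ] L2 G H) ξ) =
      (χ t : ℂ) • (specProjOf ρ α χ : L2 G H →L[ℂ] L2 G H) ξ := by
  set η := (specProjOf ρ α χ : L2 G H →L[ℂ] L2 G H) ξ with hη
  have hk : η =ᵐ[haarProb G] fun s => ∫ r, ρ (regKernel α (charSMul χ⁻¹ 1) (s, r)) (ξ r)
      ∂haarProb G := kernelOp_coe ρ (regKernel α (charSMul χ⁻¹ 1)) ξ
  have mp := measurePreserving_mul_left (haarProb G) t⁻¹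
  apply Lp.ext
  filter_upwards [Lp.coeFn_compMeasurePreserving η mp, Lp.coeFn_smul (χ t : ℂ) η, hk,
    mp.quasiMeasurePreserving.ae hk] with s h1 h2 h3 h4
  refine (h1.trans h4).trans ?_
  rw [h2, Pi.smul_apply, h3, ← integral_smul]
  congr 1
  ext1 r
  have e : (χ⁻¹ (t⁻¹ * s * r⁻¹) : ℂ) = χ t * χ⁻¹ (s * r⁻¹) := by
    rw [mul_assoc, map_mul, Circle.coe_mul]
    congr 2
    change (χ t⁻¹)⁻¹ = χ t
    rw [map_inv, inv_inv]
  simp only [regKernel, charSMul, ContinuousMap.coe_mk, map_smul, smul_apply, smul_smul, e,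
    ContinuousMap.one_apply, map_one]

end Actions

section Main

variable {G : Type v} [CommGroup G] [TopologicalSpace G] [IsTopologicalGroup G] [CompactSpace G]
  [T2Space G] [MeasurableSpace G] [BorelSpace G]

instance {A : Type u} [CStarAlgebra A] {H : Type*} [NormedAddCommGroup H] [InnerProductSpace ℂ H]
    [CompleteSpace H] (ρ : A →⋆ₐ[ℂ] (H →L[ℂ] H)) :
    IsClosed (tensorCompactsOf G ρ : Set (L2 G H →L[ℂ] L2 G H)) :=
  NonUnitalStarSubalgebra.isClosed_topologicalClosure _

variable {A : Type u} [CStarAlgebra A] [PartialOrder A] [StarOrderedRing A]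

variable (G A) in
/-- The C⋆-algebra `A ⊗ 𝒦(L²(G))`, with `A` in its universal (hence faithful) representation. -/
def TensorCompacts : Type _ := tensorCompactsOf G (univRep A)

noncomputable instance : NonUnitalCStarAlgebra (TensorCompacts G A) :=
  inferInstanceAs (NonUnitalCStarAlgebra (tensorCompactsOf G (univRep A)))

/-- The crossed product `A ⋊_α G`, in the regular representation on `L²(G, H)` for the universal
(hence faithful) representation of `A` on `H`. Since the compact group `G` is amenable, this is
both the full and the reduced crossed product. -/
def CrossedProduct (α : CAction G A) : Type _ := crossedProductOf (univRep A) α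

noncomputable instance (α : CAction G A) : NonUnitalCStarAlgebra (CrossedProduct α) :=
  inferInstanceAs (NonUnitalCStarAlgebra (crossedProductOf (univRep A) α))

variable (G A) in
/-- The embedding `a ↦ a ⊗ e` of `A` into `A ⊗ 𝒦(L²(G))`, where `e` is the rank-one projection onto
the constant functions. -/
noncomputable def corner : A →⋆ₙₐ[ℂ] TensorCompacts G A := cornerOf (univRep A)

/-- The inclusion `ι : A ⋊_α G ⊆ A ⊗ 𝒦(L²(G))`. -/
noncomputable def incl (α : CAction G A) : CrossedProduct α →⋆ₙₐ[ℂ] TensorCompacts G A :=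
  inclOf (univRep A) α

/-- The dual action `α̂` of the dual group of `G` on `A ⋊_α G`. -/
noncomputable def dualAction (α : CAction G A) (χ : PontryaginDual G) :
    CrossedProduct α →⋆ₙₐ[ℂ] CrossedProduct α :=
  dualActionOf (univRep A) α χ

/-- The spectral projections `P_α(χ) ∈ A ⋊_α G` of the canonical unitary representation `λ`. -/
noncomputable def specProj (α : CAction G A) (χ : PontryaginDual G) : CrossedProduct α :=
  specProjOf (univRep A) α χ

theorem specProj_isStarProjection (α : CAction G A) (χ : PontryaginDual G) :
    IsStarProjection (specProj α χ) := specProjOf_isStarProjection (univRep A) α χ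

open Classical in
/-- The natural map `ι_* : K₀(A ⋊_α G) → K₀(A)`: the map `K₀(A ⋊_α G) → K₀(A ⊗ 𝒦(L²(G)))` induced by
the inclusion, followed by the inverse of the stability isomorphism
`K₀(A) ≅ K₀(A ⊗ 𝒦(L²(G)))` induced by `a ↦ a ⊗ e`. (The value in the second case is irrelevant: by
stability of K-theory this case does not occur.) -/
noncomputable def iota₀ (α : CAction G A) : K₀ (CrossedProduct α) →+ K₀ A :=
  if h : Function.Bijective (K₀.map (corner G A)) then
    (AddEquiv.ofBijective (K₀.map (corner G A)) h).symm.toAddMonoidHom.comp (K₀.map (incl α))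
  else 0

open Classical in
/-- The natural map `ι_* : K₁(A ⋊_α G) → K₁(A)`, defined in the same way. -/
noncomputable def iota₁ (α : CAction G A) : K₁ (CrossedProduct α) →* K₁ A :=
  if h : Function.Bijective (K₁.map (corner G A)) then
    (MulEquiv.ofBijective (K₁.map (corner G A)) h).symm.toMonoidHom.comp (K₁.map (incl α))
  else 1

/-- The relation `y = ι_*(x)` between `x ∈ K₀(A ⋊_α G)` and `y ∈ K₀(A)`, without inverting the
stability isomorphism: `x` and `y` have the same image in `K₀(A ⊗ 𝒦(L²(G)))`. -/
def IsIota₀ (α : CAction G A) (x : K₀ (CrossedProduct α)) (y : K₀ A) : Prop :=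
  K₀.map (incl α) x = K₀.map (corner G A) y

/-- The relation `y = ι_*(x)` between `x ∈ K₁(A ⋊_α G)` and `y ∈ K₁(A)`. -/
def IsIota₁ (α : CAction G A) (x : K₁ (CrossedProduct α)) (y : K₁ A) : Prop :=
  K₁.map (incl α) x = K₁.map (corner G A) y

theorem isIota₀_iff (α : CAction G A) (h : Function.Bijective (K₀.map (corner G A)))
    (x : K₀ (CrossedProduct α)) (y : K₀ A) : IsIota₀ α x y ↔ y = iota₀ α x := by
  rw [iota₀, dif_pos h, IsIota₀]
  exact ((AddEquiv.ofBijective (K₀.map (corner G A)) h).eq_symm_apply.trans eq_comm).symm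

theorem isIota₁_iff (α : CAction G A) (h : Function.Bijective (K₁.map (corner G A)))
    (x : K₁ (CrossedProduct α)) (y : K₁ A) : IsIota₁ α x y ↔ y = iota₁ α x := by
  rw [iota₁, dif_pos h, IsIota₁]
  exact ((MulEquiv.ofBijective (K₁.map (corner G A)) h).eq_symm_apply.trans eq_comm).symm

end Main
end CrossedProd

open KTheory CrossedProd

/-! Conjugate actions are the same action up to renaming the elements of `A`, so every construction
in the statement should be carried along by one system of ⋆-isomorphisms. If `α_t = σ β_t σ⁻¹`, then
`τ = σ⁻¹` satisfies `τ α_t = β_t τ`. What is needed is an isomorphism `A ⋊_α G ≅ A ⋊_β G` induced by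
`τ`, compatible with the inclusions, the dual actions and the spectral projections.

The algebras here are concrete algebras of operators on `L²(G, H)`, where `H` carries the universal
representation `ρ` of `A`, so `τ` has to be implemented spatially. A single GNS representation need
not allow this, but the universal one does: `τ` permutes the positive functionals by `f ↦ f ∘ τ`,
and `[a] ↦ [τ a]` is an isometry from the GNS space of `f ∘ τ` to that of `f`. These isometries
assemble to a unitary `W` with `W ρ(a) = ρ(τ a) W` (`univUnitary_univRep`).

Conjugation by `1 ⊗ W` then turns an integral operator with kernel `k` into the one with kernel `τ ∘
k` (`adCongr_kernelOp`). Since the generators of the crossed product and the corner `a ⊗ e` are such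
operators, this one automorphism restricts to `A ⋊_α G ≅ A ⋊_β G` and to `τ ⊗ id` on `A ⊗ 𝒦(L²(G))`.
It commutes with multiplication by characters, hence intertwines the dual actions, and it fixes
scalar-valued functions in `C(G, A)`, hence matches the spectral projections.

Applying the functors `K₀` and `K₁` gives all the assertions, with the second isomorphism equal to
`τ_*`. The compatibility with `ι_*` is first proved for the relation "same image in the K-group of
`A ⊗ 𝒦(L²(G))`" (`isIota₀_congr`, `isIota₁_congr`), which needs no stability theorem, and then
deduced for the maps `iota₀` and `iota₁`. -/

namespace KTheory

/-! ### Functoriality of `K₀` and of its positive cone -/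

section KZeroFunctor

theorem V.map_id {R : Type*} [Ring R] [StarRing R] [Algebra ℂ R] (x : V R) :
    V.map (StarAlgHom.id ℂ R) x = x := by
  induction x using Quotient.inductionOn with | _ p
  rfl

theorem K₀₀.map_id {R : Type*} [Ring R] [StarRing R] [Algebra ℂ R] (x : K₀₀ R) :
    K₀₀.map (StarAlgHom.id ℂ R) x = x := by
  have : K₀₀.map (StarAlgHom.id ℂ R) = AddMonoidHom.id (K₀₀ R) := by
    -- A homomorphism out of the Grothendieck group is determined by its values on `V R`.
    apply Algebra.GrothendieckAddGroup.lift.symm.injective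
    ext x
    change K₀₀.map _ (Algebra.GrothendieckAddGroup.of x) = Algebra.GrothendieckAddGroup.of x
    rw [K₀₀.map_of, V.map_id]
  exact DFunLike.congr_fun this x

variable {A B C : Type*} [NonUnitalCStarAlgebra A] [NonUnitalCStarAlgebra B]
  [NonUnitalCStarAlgebra C]

theorem K₀.map_comp (g : B →⋆ₙₐ[ℂ] C) (f : A →⋆ₙₐ[ℂ] B) (x : K₀ A) :
    K₀.map (g.comp f) x = K₀.map g (K₀.map f x) := by
  apply Subtype.ext
  change K₀₀.map (Unitization.starMap (g.comp f)) x.1 =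
    K₀₀.map (Unitization.starMap g) (K₀₀.map (Unitization.starMap f) x.1)
  rw [K₀₀.map_map, Unitization.starMap_comp]

theorem K₀.map_id (x : K₀ A) : K₀.map (NonUnitalStarAlgHom.id ℂ A) x = x := by
  apply Subtype.ext
  change K₀₀.map (Unitization.starMap (NonUnitalStarAlgHom.id ℂ A)) x.1 = x.1
  rw [Unitization.starMap_id, K₀₀.map_id]

/-- The isomorphism of `K₀`-groups induced by an isomorphism of C⋆-algebras. -/
noncomputable def K₀.congr (e : A ≃⋆ₐ[ℂ] B) : K₀ A ≃+ K₀ B :=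
  (K₀.map (e : A →⋆ₙₐ[ℂ] B)).toAddEquiv (K₀.map (e.symm : B →⋆ₙₐ[ℂ] A))
    (by
      ext1 x
      rw [AddMonoidHom.comp_apply, ← K₀.map_comp, AddMonoidHom.id_apply]
      convert K₀.map_id x
      ext a
      exact e.symm_apply_apply a)
    (by
      ext1 x
      rw [AddMonoidHom.comp_apply, ← K₀.map_comp, AddMonoidHom.id_apply]
      convert K₀.map_id x
      ext a
      exact e.apply_symm_apply a)

theorem K₀.congr_apply (e : A ≃⋆ₐ[ℂ] B) (x : K₀ A) :
    K₀.congr e x = K₀.map (e : A →⋆ₙₐ[ℂ] B) x := rfl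

theorem K₀.congr_symm_apply (e : A ≃⋆ₐ[ℂ] B) (x : K₀ B) :
    (K₀.congr e).symm x = K₀.map (e.symm : B →⋆ₙₐ[ℂ] A) x := rfl

/-- A commuting square of ⋆-homomorphisms stays commuting under the functor `K₀`. Used for the dual
actions and, through the next lemma, for the inclusion and the corner embedding. -/
theorem K₀.congr_map {D : Type*} [NonUnitalCStarAlgebra D] {e : A ≃⋆ₐ[ℂ] B} {e' : C ≃⋆ₐ[ℂ] D}
    {f : A →⋆ₙₐ[ℂ] C} {g : B →⋆ₙₐ[ℂ] D} (h : ∀ a, e' (f a) = g (e a)) (x : K₀ A) :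
    K₀.congr e' (K₀.map f x) = K₀.map g (K₀.congr e x) := by
  rw [K₀.congr_apply, K₀.congr_apply, ← K₀.map_comp, ← K₀.map_comp]
  congr 2
  ext1 a
  exact h a

/-- Two naturality squares share the isomorphism `E` on the target side, and `E_*` is injective.
This is the abstract form of the transport of the relation `IsIota₀`; neither `f_*` nor `f'_*` has
to be invertible. -/
theorem K₀.map_eq_map_iff_congr {A' B' D : Type*} [NonUnitalCStarAlgebra A']
    [NonUnitalCStarAlgebra B'] [NonUnitalCStarAlgebra D] {e : A ≃⋆ₐ[ℂ] B} {e' : A' ≃⋆ₐ[ℂ] B'}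
    {E : C ≃⋆ₐ[ℂ] D} {f : A →⋆ₙₐ[ℂ] C} {f' : A' →⋆ₙₐ[ℂ] C} {g : B →⋆ₙₐ[ℂ] D}
    {g' : B' →⋆ₙₐ[ℂ] D} (h : ∀ a, E (f a) = g (e a)) (h' : ∀ a, E (f' a) = g' (e' a))
    (x : K₀ A) (y : K₀ A') :
    K₀.map f x = K₀.map f' y ↔ K₀.map g (K₀.congr e x) = K₀.map g' (K₀.congr e' y) := by
  rw [← K₀.congr_map h, ← K₀.congr_map h', EmbeddingLike.apply_eq_iff_eq]

/-- The representing matrix has its entries in `A` inside the unitization, and there the unitized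
homomorphism is just `f`. -/
theorem K₀.map_ofProj (f : A →⋆ₙₐ[ℂ] B) {n : ℕ} (p : Matrix (Fin n) (Fin n) A) (hp : IsProj p) :
    K₀.map f (K₀.ofProj p hp) = K₀.ofProj (p.map f) (hp.map f) := by
  apply Subtype.ext
  change K₀₀.map (Unitization.starMap f) (Algebra.GrothendieckAddGroup.of (V.mk _ _)) =
    Algebra.GrothendieckAddGroup.of (V.mk _ _)
  rw [K₀₀.map_of]
  congr 1
  change V.mk _ _ = V.mk _ _
  congr 1
  ext1 i j
  exact Unitization.starMap_inr f (p i j)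

/-- The target projection `q` is a separate variable with its own proof `hq`, so that the lemma
applies when `f p` equals `q` only propositionally. -/
theorem K₀.map_ofElem (f : A →⋆ₙₐ[ℂ] B) (p : A) (hp : IsStarProjection p) {q : B}
    (hq : IsStarProjection q) (h : f p = q) : K₀.map f (K₀.ofElem p hp) = K₀.ofElem q hq := by
  subst h
  exact K₀.map_ofProj f _ _

theorem K₀.map_mem_pos (f : A →⋆ₙₐ[ℂ] B) {x : K₀ A} (hx : x ∈ K₀.pos A) :
    K₀.map f x ∈ K₀.pos B := by
  obtain ⟨n, p, hp, rfl⟩ := hx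
  exact ⟨n, p.map f, hp.map f, K₀.map_ofProj f p hp⟩

/-- Every ⋆-homomorphism preserves the cones; applying this to `e` and to `e.symm` shows that the
cone is mapped onto the cone. -/
theorem K₀.mem_pos_iff_congr (e : A ≃⋆ₐ[ℂ] B) (x : K₀ A) :
    x ∈ K₀.pos A ↔ K₀.congr e x ∈ K₀.pos B := by
  refine ⟨fun h => K₀.map_mem_pos _ h, fun h => ?_⟩
  rw [← (K₀.congr e).symm_apply_apply x, K₀.congr_symm_apply]
  exact K₀.map_mem_pos _ h

end KZeroFunctor

/-! ### Functoriality of `K₁` -/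

section KOneFunctor

theorem K₁₁.map_map {R S T : Type*} [CStarAlgebra R] [CStarAlgebra S] [CStarAlgebra T]
    (f : R →⋆ₐ[ℂ] S) (g : S →⋆ₐ[ℂ] T) (x : K₁₁ R) :
    K₁₁.map g (K₁₁.map f x) = K₁₁.map (g.comp f) x := by
  induction x using DirectLimit.induction with | _ n x
  induction x using QuotientGroup.induction_on with | _ u
  -- On a representing unitary matrix both sides apply `g ∘ f` entrywise.
  rfl

theorem K₁₁.map_id {R : Type*} [CStarAlgebra R] (x : K₁₁ R) :
    K₁₁.map (StarAlgHom.id ℂ R) x = x := by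
  induction x using DirectLimit.induction with | _ n x
  induction x using QuotientGroup.induction_on with | _ u
  rfl

variable {A B C : Type*} [NonUnitalCStarAlgebra A] [NonUnitalCStarAlgebra B]
  [NonUnitalCStarAlgebra C]

theorem K₁.map_comp (g : B →⋆ₙₐ[ℂ] C) (f : A →⋆ₙₐ[ℂ] B) (x : K₁ A) :
    K₁.map (g.comp f) x = K₁.map g (K₁.map f x) := by
  refine Eq.trans ?_ (K₁₁.map_map (Unitization.starMap f) (Unitization.starMap g) x).symm
  rw [← Unitization.starMap_comp]
  rfl

theorem K₁.map_id (x : K₁ A) : K₁.map (NonUnitalStarAlgHom.id ℂ A) x = x := by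
  change K₁₁.map (Unitization.starMap (NonUnitalStarAlgHom.id ℂ A)) x = x
  rw [Unitization.starMap_id]
  exact K₁₁.map_id x

/-- The isomorphism of `K₁`-groups induced by an isomorphism of C⋆-algebras. -/
noncomputable def K₁.congr (e : A ≃⋆ₐ[ℂ] B) : K₁ A ≃* K₁ B :=
  (K₁.map (e : A →⋆ₙₐ[ℂ] B)).toMulEquiv (K₁.map (e.symm : B →⋆ₙₐ[ℂ] A))
    (by
      ext1 x
      rw [MonoidHom.comp_apply, ← K₁.map_comp, MonoidHom.id_apply]
      convert K₁.map_id x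
      ext a
      exact e.symm_apply_apply a)
    (by
      ext1 x
      rw [MonoidHom.comp_apply, ← K₁.map_comp, MonoidHom.id_apply]
      convert K₁.map_id x
      ext a
      exact e.apply_symm_apply a)

theorem K₁.congr_apply (e : A ≃⋆ₐ[ℂ] B) (x : K₁ A) :
    K₁.congr e x = K₁.map (e : A →⋆ₙₐ[ℂ] B) x := rfl

theorem K₁.congr_map {D : Type*} [NonUnitalCStarAlgebra D] {e : A ≃⋆ₐ[ℂ] B} {e' : C ≃⋆ₐ[ℂ] D}
    {f : A →⋆ₙₐ[ℂ] C} {g : B →⋆ₙₐ[ℂ] D} (h : ∀ a, e' (f a) = g (e a)) (x : K₁ A) :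
    K₁.congr e' (K₁.map f x) = K₁.map g (K₁.congr e x) := by
  rw [K₁.congr_apply, K₁.congr_apply, ← K₁.map_comp, ← K₁.map_comp]
  congr 2
  ext1 a
  exact h a

theorem K₁.map_eq_map_iff_congr {A' B' D : Type*} [NonUnitalCStarAlgebra A']
    [NonUnitalCStarAlgebra B'] [NonUnitalCStarAlgebra D] {e : A ≃⋆ₐ[ℂ] B} {e' : A' ≃⋆ₐ[ℂ] B'}
    {E : C ≃⋆ₐ[ℂ] D} {f : A →⋆ₙₐ[ℂ] C} {f' : A' →⋆ₙₐ[ℂ] C} {g : B →⋆ₙₐ[ℂ] D}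
    {g' : B' →⋆ₙₐ[ℂ] D} (h : ∀ a, E (f a) = g (e a)) (h' : ∀ a, E (f' a) = g' (e' a))
    (x : K₁ A) (y : K₁ A') :
    K₁.map f x = K₁.map f' y ↔ K₁.map g (K₁.congr e x) = K₁.map g' (K₁.congr e' y) := by
  rw [← K₁.congr_map h, ← K₁.congr_map h', EmbeddingLike.apply_eq_iff_eq]

end KOneFunctor

end KTheory

namespace CrossedProd

set_option linter.unusedSectionVars false

universe u v

open scoped ComplexOrder ENNReal
open UniformSpace MeasureTheory

/-! ### Automorphisms are unitarily implemented in the universal representation -/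

section UniversalRep

variable {A : Type u} [CStarAlgebra A] [PartialOrder A] [StarOrderedRing A]

/-- The pullback `f ∘ τ` of a positive functional along an automorphism. -/
noncomputable def compAut (τ : A ≃⋆ₐ[ℂ] A) (f : A →ₚ[ℂ] ℂ) : A →ₚ[ℂ] ℂ where
  toFun a := f (τ a)
  map_add' a b := by rw [map_add, map_add]
  map_smul' c a := by rw [map_smul, map_smul]; rfl
  monotone' a b h := OrderHomClass.mono f (OrderHomClass.mono τ h)

theorem compAut_apply (τ : A ≃⋆ₐ[ℂ] A) (f : A →ₚ[ℂ] ℂ) (a : A) : compAut τ f a = f (τ a) := rfl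

/-- Pullback along an automorphism, as a permutation of the positive functionals. -/
noncomputable def compAutEquiv (τ : A ≃⋆ₐ[ℂ] A) : (A →ₚ[ℂ] ℂ) ≃ (A →ₚ[ℂ] ℂ) where
  toFun := compAut τ
  invFun := compAut τ.symm
  left_inv f := by ext a; simp [compAut_apply]
  right_inv f := by ext a; simp [compAut_apply]

variable {τ : A ≃⋆ₐ[ℂ] A} {f g : A →ₚ[ℂ] ℂ}

/-- The isometry of pre-Hilbert spaces `[a]_g ↦ [τ a]_f`, if `g = f ∘ τ`. -/
noncomputable def preGNSMap (h : ∀ a, g a = f (τ a)) : g.PreGNS →ₗᵢ[ℂ] f.PreGNS where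
  toFun a := f.toPreGNS (τ (g.ofPreGNS a))
  map_add' a b := by simp only [map_add]
  map_smul' c a := by simp only [map_smul, RingHom.id_apply]
  norm_map' a := by
    change ‖f.toPreGNS (τ (g.ofPreGNS a))‖ = ‖a‖
    -- The norms agree because `f(τ(a)⋆ τ(a)) = f(τ(a⋆ a)) = g(a⋆ a)`.
    rw [PositiveLinearMap.preGNS_norm_def, PositiveLinearMap.preGNS_norm_def, h, map_mul τ,
      map_star τ]
    rfl

/-- The isometry `[a]_g ↦ [τ a]_f` of GNS spaces, if `g = f ∘ τ`. -/
noncomputable def gnsMap (h : ∀ a, g a = f (τ a)) : g.GNS →ₗᵢ[ℂ] f.GNS where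
  toLinearMap := ((preGNSMap h).toContinuousLinearMap.completion : g.GNS →L[ℂ] f.GNS)
  norm_map' x := by
    change ‖(preGNSMap h).toContinuousLinearMap.completion x‖ = ‖x‖
    induction x using Completion.induction_on with
    | hp => apply isClosed_eq <;> fun_prop
    | ih a => simp [Completion.norm_coe]

theorem gnsMap_coe (h : ∀ a, g a = f (τ a)) (a : g.PreGNS) :
    gnsMap h (a : g.GNS) = (f.toPreGNS (τ (g.ofPreGNS a)) : f.GNS) :=
  ContinuousLinearMap.completion_apply_coe (preGNSMap h).toContinuousLinearMap a

/-- On the dense image of `A` this is multiplicativity, `τ(a b) = τ(a) τ(b)`; both sides are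
continuous in the vector. -/
theorem gnsMap_gnsStarAlgHom (h : ∀ a, g a = f (τ a)) (a : A) (x : g.GNS) :
    gnsMap h (g.gnsStarAlgHom a x) = f.gnsStarAlgHom (τ a) (gnsMap h x) := by
  induction x using Completion.induction_on with
  | hp => apply isClosed_eq <;> fun_prop
  | ih x =>
    change gnsMap h (g.gnsNonUnitalStarAlgHom a x) = f.gnsNonUnitalStarAlgHom (τ a) (gnsMap h x)
    rw [gnsMap_coe, PositiveLinearMap.gnsNonUnitalStarAlgHom_apply_coe, gnsMap_coe,
      PositiveLinearMap.gnsNonUnitalStarAlgHom_apply_coe]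
    simp

/-- Shows that the isometries for `τ` and `τ⁻¹` are mutually inverse. The functional `k = f ∘ τ ∘
τ'` is only propositionally equal to `f`, so the spaces `k.GNS` and `f.GNS` are different types.
Taking a whole family `x` and the equation `hk` as data avoids a transport between them. -/
theorem gnsMap_gnsMap {τ' : A ≃⋆ₐ[ℂ] A} {k : A →ₚ[ℂ] ℂ} (h : ∀ a, g a = f (τ a))
    (h' : ∀ a, k a = g (τ' a)) (hk : k = f) (hτ : ∀ a, τ (τ' a) = a) (x : ∀ f : A →ₚ[ℂ] ℂ, f.GNS) :
    gnsMap h (gnsMap h' (x k)) = x f := by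
  subst hk
  induction x k using Completion.induction_on with
  | hp => apply isClosed_eq <;> fun_prop
  | ih x =>
    rw [gnsMap_coe, gnsMap_coe]
    simp [hτ]

theorem summable_sq_lp (x : lp (fun f : A →ₚ[ℂ] ℂ => f.GNS) 2) :
    Summable fun f => ‖x f‖ ^ (2 : ℝ≥0∞).toReal :=
  (memℓp_gen_iff (p := 2) (by norm_num)).1 (lp.memℓp x)

/-- Each component map is isometric and `f ↦ f ∘ τ` permutes the index set, so the sum of squares is
only rearranged. -/
theorem memℓp_gnsMap (τ : A ≃⋆ₐ[ℂ] A) (x : lp (fun f : A →ₚ[ℂ] ℂ => f.GNS) 2) :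
    Memℓp (fun f : A →ₚ[ℂ] ℂ => gnsMap (compAut_apply τ f) (x (compAut τ f))) 2 := by
  refine memℓp_gen ?_
  simp only [LinearIsometry.norm_map]
  exact (compAutEquiv τ).summable_iff.2 (summable_sq_lp x)

/-- The operator `(W x)_f = [τ] x_{f ∘ τ}` on the Hilbert sum of the GNS spaces. -/
noncomputable def univMap (τ : A ≃⋆ₐ[ℂ] A) (x : lp (fun f : A →ₚ[ℂ] ℂ => f.GNS) 2) :
    lp (fun f : A →ₚ[ℂ] ℂ => f.GNS) 2 :=
  ⟨fun f => gnsMap (compAut_apply τ f) (x (compAut τ f)), memℓp_gnsMap τ x⟩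

theorem univMap_apply (τ : A ≃⋆ₐ[ℂ] A) (x : lp (fun f : A →ₚ[ℂ] ℂ => f.GNS) 2) (f : A →ₚ[ℂ] ℂ) :
    univMap τ x f = gnsMap (compAut_apply τ f) (x (compAut τ f)) := rfl

/-- The unitary operator on the Hilbert sum of the GNS spaces that implements `τ`. -/
noncomputable def univUnitaryLp (τ : A ≃⋆ₐ[ℂ] A) :
    lp (fun f : A →ₚ[ℂ] ℂ => f.GNS) 2 ≃ₗᵢ[ℂ] lp (fun f : A →ₚ[ℂ] ℂ => f.GNS) 2 where
  toFun := univMap τ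
  invFun := univMap τ.symm
  map_add' x y := by
    ext f
    exact map_add (gnsMap (compAut_apply τ f)) _ _
  map_smul' c x := by
    ext f
    exact map_smul (gnsMap (compAut_apply τ f)) _ _
  left_inv x := by
    ext f
    -- Pullback is contravariant: the component at `f` involves `x` at `compAut τ (compAut τ.symm
    -- f)`, so the left inverse here rests on the right inverse for functionals.
    exact gnsMap_gnsMap _ _ ((compAutEquiv τ).right_inv f) τ.symm_apply_apply x
  right_inv x := by
    ext f
    exact gnsMap_gnsMap _ _ ((compAutEquiv τ).left_inv f) τ.apply_symm_apply x
  norm_map' x := by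
    change ‖univMap τ x‖ = ‖x‖
    rw [lp.norm_eq_tsum_rpow (by norm_num), lp.norm_eq_tsum_rpow (by norm_num)]
    simp only [univMap_apply, LinearIsometry.norm_map]
    congr 1
    exact (compAutEquiv τ).tsum_eq fun f => ‖x f‖ ^ (2 : ℝ≥0∞).toReal

/-- The unitary operator on the space of the universal representation that implements `τ`. -/
noncomputable def univUnitary (τ : A ≃⋆ₐ[ℂ] A) : HilbU A ≃ₗᵢ[ℂ] HilbU A := univUnitaryLp τ

/-- Holds in each component `f`, where it is the intertwining property of the isometry from the GNS
space of `f ∘ τ` to that of `f`. This is the hypothesis `hW` of everything that follows. -/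
theorem univUnitary_univRep (τ : A ≃⋆ₐ[ℂ] A) (a : A) (x : HilbU A) :
    univUnitary τ (univRep A a x) = univRep A (τ a) (univUnitary τ x) := by
  apply lp.ext
  ext f
  exact gnsMap_gnsStarAlgHom (compAut_apply τ f) a _

end UniversalRep

/-! ### Restricting isomorphisms to closed ⋆-subalgebras -/

/-- A ⋆-isomorphism of C⋆-algebras is isometric, so the preimage of `T` is a closed ⋆-subalgebra;
hence it suffices to check generators. -/
theorem map_mem_of_mem_closure_adjoin {B C : Type*} [NonUnitalCStarAlgebra B]
    [NonUnitalCStarAlgebra C] (e : B ≃⋆ₐ[ℂ] C) {s : Set B} {T : NonUnitalStarSubalgebra ℂ C}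
    (hT : IsClosed (T : Set C)) (h : ∀ x ∈ s, e x ∈ T) {x : B}
    (hx : x ∈ (NonUnitalStarAlgebra.adjoin ℂ s).topologicalClosure) : e x ∈ T := by
  have hle : (NonUnitalStarAlgebra.adjoin ℂ s).topologicalClosure ≤ T.comap e :=
    NonUnitalStarSubalgebra.topologicalClosure_minimal _ (NonUnitalStarAlgebra.adjoin_le h)
      (hT.preimage (StarAlgEquiv.isometry e).continuous)
  exact hle hx

/-- The isomorphism of ⋆-subalgebras obtained by restricting an isomorphism of the ambient
algebras. -/
def restrictEquiv {B C : Type*} [NonUnitalSemiring B] [StarRing B] [Module ℂ B]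
    [NonUnitalSemiring C] [StarRing C] [Module ℂ C] (e : B ≃⋆ₐ[ℂ] C)
    (S : NonUnitalStarSubalgebra ℂ B) (T : NonUnitalStarSubalgebra ℂ C)
    (h : ∀ x ∈ S, e x ∈ T) (h' : ∀ y ∈ T, e.symm y ∈ S) : S ≃⋆ₐ[ℂ] T where
  toFun x := ⟨e x, h x x.2⟩
  invFun y := ⟨e.symm y, h' y y.2⟩
  left_inv _ := Subtype.ext (e.symm_apply_apply _)
  right_inv _ := Subtype.ext (e.apply_symm_apply _)
  map_mul' _ _ := Subtype.ext (map_mul e _ _)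
  map_add' _ _ := Subtype.ext (map_add e _ _)
  map_star' _ := Subtype.ext (map_star e _)
  map_smul' c _ := Subtype.ext (map_smul e c _)

/-! ### Conjugation by `1 ⊗ W` on `L²(G, H)`: integral operators and compacts -/

section LTwo

variable {G : Type v} [CommGroup G] [TopologicalSpace G] [IsTopologicalGroup G] [CompactSpace G]
  [T2Space G] [MeasurableSpace G] [BorelSpace G]
variable {H K : Type*} [NormedAddCommGroup H] [InnerProductSpace ℂ H] [CompleteSpace H]
  [NormedAddCommGroup K] [InnerProductSpace ℂ K] [CompleteSpace K]

theorem compLp_coe (W : H ≃ₗᵢ[ℂ] K) (ξ : L2 G H) :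
    (W : H →L[ℂ] K).compLp ξ =ᵐ[haarProb G] fun s => W (ξ s) :=
  (W : H →L[ℂ] K).coeFn_compLp' ξ

/-- The unitary operator `1 ⊗ W : L²(G, H) → L²(G, K)`. -/
noncomputable def l2Congr (W : H ≃ₗᵢ[ℂ] K) : L2 G H ≃ₗᵢ[ℂ] L2 G K where
  toFun ξ := (W : H →L[ℂ] K).compLp ξ
  invFun ξ := (W.symm : K →L[ℂ] H).compLp ξ
  map_add' ξ η := ((W : H →L[ℂ] K).compLpₗ 2 (haarProb G)).map_add ξ η
  map_smul' c ξ := ((W : H →L[ℂ] K).compLpₗ 2 (haarProb G)).map_smul c ξ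
  left_inv ξ := by
    apply Lp.ext
    filter_upwards [compLp_coe W.symm ((W : H →L[ℂ] K).compLp ξ), compLp_coe W ξ] with s h1 h2
    rw [h1, h2, W.symm_apply_apply]
  right_inv ξ := by
    apply Lp.ext
    filter_upwards [compLp_coe W ((W.symm : K →L[ℂ] H).compLp ξ), compLp_coe W.symm ξ]
      with s h1 h2
    rw [h1, h2, W.apply_symm_apply]
  norm_map' ξ := by
    change ‖(W : H →L[ℂ] K).compLp ξ‖ = ‖ξ‖
    rw [Lp.norm_def, Lp.norm_def]
    congr 1
    refine eLpNorm_congr_norm_ae ?_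
    filter_upwards [compLp_coe W ξ] with s hs
    rw [hs, W.norm_map]

theorem l2Congr_coe (W : H ≃ₗᵢ[ℂ] K) (ξ : L2 G H) :
    l2Congr W ξ =ᵐ[haarProb G] fun s => W (ξ s) := compLp_coe W ξ

theorem l2Congr_tensorVec (W : H ≃ₗᵢ[ℂ] K) (f : L2 G ℂ) (h : H) :
    l2Congr W (tensorVec f h) = tensorVec f (W h) := by
  apply Lp.ext
  filter_upwards [l2Congr_coe W (tensorVec f h), tensorVec_coe f h, tensorVec_coe f (W h)]
    with s h1 h2 h3
  rw [h1, h2, h3, map_smul]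

/-- At each point of `G` the character is a scalar and `W` is linear. This is the source of the
equivariance for the dual actions. -/
theorem l2Congr_charMul (W : H ≃ₗᵢ[ℂ] K) (χ : PontryaginDual G) (ξ : L2 G H) :
    l2Congr W (charMul χ ξ) = charMul χ (l2Congr W ξ) := by
  apply Lp.ext
  filter_upwards [l2Congr_coe W (charMul χ ξ), charMul_coe χ ξ, charMul_coe χ (l2Congr W ξ),
    l2Congr_coe W ξ] with s h1 h2 h3 h4
  rw [h1, h2, h3, h4, map_smul]

/-- The isomorphism `Ad (1 ⊗ W)` of algebras of bounded operators. -/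
noncomputable def adCongr (W : H ≃ₗᵢ[ℂ] K) :
    (L2 G H →L[ℂ] L2 G H) ≃⋆ₐ[ℂ] (L2 G K →L[ℂ] L2 G K) :=
  (l2Congr W).conjStarAlgEquiv

theorem adCongr_apply (W : H ≃ₗᵢ[ℂ] K) (T : L2 G H →L[ℂ] L2 G H) (ξ : L2 G K) :
    adCongr W T ξ = l2Congr W (T (l2Congr W.symm ξ)) := rfl

theorem adCongr_adChar (W : H ≃ₗᵢ[ℂ] K) (χ : PontryaginDual G) (T : L2 G H →L[ℂ] L2 G H) :
    adCongr W (adChar χ T) = adChar χ (adCongr W T) := by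
  ext1 ξ
  rw [adCongr_apply, adChar_apply, adChar_apply, adCongr_apply, l2Congr_charMul, l2Congr_charMul]

variable {A : Type u} [CStarAlgebra A] {ρ : A →⋆ₐ[ℂ] (H →L[ℂ] H)} {π : A →⋆ₐ[ℂ] (K →L[ℂ] K)}
  {τ : A ≃⋆ₐ[ℂ] A} {W : H ≃ₗᵢ[ℂ] K}

/-- The function `x ↦ τ(F(x))`. -/
noncomputable def autComp {X : Type*} [TopologicalSpace X] (τ : A ≃⋆ₐ[ℂ] A) (F : C(X, A)) :
    C(X, A) :=
  ⟨fun x => τ (F x), (StarAlgEquiv.isometry τ).continuous.comp F.continuous⟩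

/-- The hypothesis `hW` for the pair `W⁻¹`, `τ⁻¹`: each inclusion of algebras proved from `hW`
thereby also holds for the inverse conjugation. -/
theorem intertwine_symm (hW : ∀ a h, W (ρ a h) = π (τ a) (W h)) (a : A) (k : K) :
    W.symm (π a k) = ρ (τ.symm a) (W.symm k) := by
  rw [LinearIsometryEquiv.symm_apply_eq, hW, StarAlgEquiv.apply_symm_apply,
    LinearIsometryEquiv.apply_symm_apply]

/-- `W` passes under the integral and `W ρ(k(s, t)) W⁻¹ = π(τ(k(s, t)))`. The corner embedding, the
generators of the crossed product and the spectral projections are all handled through this formula.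
-/
theorem adCongr_kernelOp (hW : ∀ a h, W (ρ a h) = π (τ a) (W h)) (k : C(G × G, A)) :
    adCongr W (kernelOp ρ k) = kernelOp π (autComp τ k) := by
  ext1 ξ
  apply Lp.ext
  filter_upwards [l2Congr_coe W (kernelOp ρ k (l2Congr W.symm ξ)),
    kernelOp_coe ρ k (l2Congr W.symm ξ), kernelOp_coe π (autComp τ k) ξ] with s h1 h2 h3
  rw [adCongr_apply, h1, h2, h3]
  -- As `W` is invertible, it commutes with the integral without any integrability check.
  refine ((W : H ≃L[ℂ] K).integral_comp_comm _).symm.trans ?_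
  refine integral_congr_ae ?_
  filter_upwards [l2Congr_coe W.symm ξ] with t ht
  rw [ht]
  refine (hW _ _).trans ?_
  rw [W.apply_symm_apply]
  rfl

/-- `1 ⊗ W` acts only on the second factor, so `k` is unchanged and in particular stays compact. -/
theorem adCongr_isElementaryTensor (hW : ∀ a h, W (ρ a h) = π (τ a) (W h)) {a : A}
    {k : L2 G ℂ →L[ℂ] L2 G ℂ} {T : L2 G H →L[ℂ] L2 G H} (hT : IsElementaryTensor ρ a k T) :
    IsElementaryTensor π (τ a) k (adCongr W T) := fun f h => by
  rw [adCongr_apply, l2Congr_tensorVec, hT, l2Congr_tensorVec, hW, W.apply_symm_apply]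

theorem adCongr_mem_tensorCompactsOf (hW : ∀ a h, W (ρ a h) = π (τ a) (W h))
    (T : L2 G H →L[ℂ] L2 G H) (hT : T ∈ tensorCompactsOf G ρ) :
    adCongr W T ∈ tensorCompactsOf G π := by
  refine map_mem_of_mem_closure_adjoin (adCongr W)
    (NonUnitalStarSubalgebra.isClosed_topologicalClosure _) ?_ hT
  rintro S ⟨a, k, hk, hS⟩
  exact NonUnitalStarSubalgebra.le_topologicalClosure _
    (NonUnitalStarAlgebra.subset_adjoin ℂ _ ⟨τ a, k, hk, adCongr_isElementaryTensor hW hS⟩)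

/-- The isomorphism `ρ(A) ⊗ 𝒦(L²(G)) ≅ π(A) ⊗ 𝒦(L²(G))` given by a unitary that intertwines `ρ` and
`π ∘ τ`. -/
noncomputable def tensorCompactsOfCongr (hW : ∀ a h, W (ρ a h) = π (τ a) (W h)) :
    tensorCompactsOf G ρ ≃⋆ₐ[ℂ] tensorCompactsOf G π :=
  restrictEquiv (adCongr W) _ _ (adCongr_mem_tensorCompactsOf hW)
    (adCongr_mem_tensorCompactsOf (intertwine_symm hW))

theorem tensorCompactsOfCongr_cornerOf (hW : ∀ a h, W (ρ a h) = π (τ a) (W h)) (a : A) :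
    tensorCompactsOfCongr hW (cornerOf (G := G) ρ a) = cornerOf π (τ a) := by
  apply Subtype.ext
  change adCongr W (constVec ∘L ρ a ∘L ContinuousLinearMap.adjoint constVec) =
    constVec ∘L π (τ a) ∘L ContinuousLinearMap.adjoint constVec
  -- `a ⊗ e` is the integral operator whose kernel is the constant `a`.
  rw [← kernelOp_const, ← kernelOp_const, adCongr_kernelOp hW]
  rfl

/-! ### Conjugation by `1 ⊗ W` on crossed products -/

variable {α β : CAction G A}

/-- Equivariance at the group element `s⁻¹`: `τ(α_s⁻¹(F(s r⁻¹))) = β_s⁻¹(τ(F(s r⁻¹)))`. Here the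
conjugacy of the actions enters the operator picture. -/
theorem autComp_regKernel (hτ : ∀ t a, τ (α.toAut t a) = β.toAut t (τ a)) (F : C(G, A)) :
    autComp τ (regKernel α F) = regKernel β (autComp τ F) := by
  ext p
  exact hτ _ _

theorem adCongr_regOp (hW : ∀ a h, W (ρ a h) = π (τ a) (W h))
    (hτ : ∀ t a, τ (α.toAut t a) = β.toAut t (τ a)) (F : C(G, A)) :
    adCongr W (regOp ρ α F) = regOp π β (autComp τ F) := by
  rw [regOp, adCongr_kernelOp hW, autComp_regKernel hτ, regOp]

theorem adCongr_mem_crossedProductOf (hW : ∀ a h, W (ρ a h) = π (τ a) (W h))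
    (hτ : ∀ t a, τ (α.toAut t a) = β.toAut t (τ a))
    (T : L2 G H →L[ℂ] L2 G H) (hT : T ∈ crossedProductOf ρ α) :
    adCongr W T ∈ crossedProductOf π β := by
  refine map_mem_of_mem_closure_adjoin (adCongr W)
    (NonUnitalStarSubalgebra.isClosed_topologicalClosure _) ?_ hT
  rintro _ ⟨F, rfl⟩
  rw [adCongr_regOp hW hτ]
  exact regOp_mem π β _

theorem equivariant_symm (hτ : ∀ t a, τ (α.toAut t a) = β.toAut t (τ a)) (t : G) (a : A) :
    τ.symm (β.toAut t a) = α.toAut t (τ.symm a) := by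
  apply EquivLike.injective τ
  rw [hτ, StarAlgEquiv.apply_symm_apply, StarAlgEquiv.apply_symm_apply]

/-- The isomorphism of crossed products given by an equivariant automorphism `τ` and a unitary that
intertwines `ρ` and `π ∘ τ`. -/
noncomputable def crossedProductOfCongr (hW : ∀ a h, W (ρ a h) = π (τ a) (W h))
    (hτ : ∀ t a, τ (α.toAut t a) = β.toAut t (τ a)) :
    crossedProductOf ρ α ≃⋆ₐ[ℂ] crossedProductOf π β :=
  restrictEquiv (adCongr W) _ _ (adCongr_mem_crossedProductOf hW hτ)
    (adCongr_mem_crossedProductOf (intertwine_symm hW) (equivariant_symm hτ))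

/-- Both isomorphisms are restrictions of the same `Ad (1 ⊗ W)`, and the inclusion does not change
the operator. -/
theorem inclOf_crossedProductOfCongr (hW : ∀ a h, W (ρ a h) = π (τ a) (W h))
    (hτ : ∀ t a, τ (α.toAut t a) = β.toAut t (τ a)) (x : crossedProductOf ρ α) :
    inclOf π β (crossedProductOfCongr hW hτ x) = tensorCompactsOfCongr hW (inclOf ρ α x) := by
  apply Subtype.ext
  exact (NonUnitalStarSubalgebra.val_inclusion _ _).trans (Eq.symm (congrArg (adCongr W)
    (NonUnitalStarSubalgebra.val_inclusion (crossedProductOf_le ρ α) x)))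

theorem crossedProductOfCongr_dualActionOf (hW : ∀ a h, W (ρ a h) = π (τ a) (W h))
    (hτ : ∀ t a, τ (α.toAut t a) = β.toAut t (τ a)) (χ : PontryaginDual G)
    (x : crossedProductOf ρ α) :
    crossedProductOfCongr hW hτ (dualActionOf ρ α χ x) =
      dualActionOf π β χ (crossedProductOfCongr hW hτ x) :=
  Subtype.ext (adCongr_adChar W χ x)

/-- The projection is the operator of the scalar-valued function `χ⁻¹ · 1`, which the unital linear
map `τ` fixes. -/
theorem crossedProductOfCongr_specProjOf (hW : ∀ a h, W (ρ a h) = π (τ a) (W h))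
    (hτ : ∀ t a, τ (α.toAut t a) = β.toAut t (τ a)) (χ : PontryaginDual G) :
    crossedProductOfCongr hW hτ (specProjOf ρ α χ) = specProjOf π β χ := by
  apply Subtype.ext
  refine (adCongr_regOp hW hτ _).trans ?_
  change regOp π β _ = regOp π β _
  congr 1
  ext t
  simp [autComp, charSMul]

end LTwo

/-! ### The universal representation: transport of `ι_*` -/

section Main

variable {G : Type v} [CommGroup G] [TopologicalSpace G] [IsTopologicalGroup G] [CompactSpace G]
  [T2Space G] [MeasurableSpace G] [BorelSpace G]
variable {A : Type u} [CStarAlgebra A] [PartialOrder A] [StarOrderedRing A]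
variable {τ : A ≃⋆ₐ[ℂ] A} {α β : CAction G A}

variable (G) in
/-- The automorphism `τ ⊗ id` of `A ⊗ 𝒦(L²(G))`. -/
noncomputable def tensorCompactsCongr (τ : A ≃⋆ₐ[ℂ] A) :
    TensorCompacts G A ≃⋆ₐ[ℂ] TensorCompacts G A :=
  tensorCompactsOfCongr (univUnitary_univRep τ)

/-- The isomorphism of crossed products induced by an equivariant automorphism. -/
noncomputable def crossedProductCongr (hτ : ∀ t a, τ (α.toAut t a) = β.toAut t (τ a)) :
    CrossedProduct α ≃⋆ₐ[ℂ] CrossedProduct β :=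
  crossedProductOfCongr (univUnitary_univRep τ) hτ

theorem tensorCompactsCongr_corner (τ : A ≃⋆ₐ[ℂ] A) (a : A) :
    tensorCompactsCongr G τ (corner G A a) = corner G A (τ a) :=
  tensorCompactsOfCongr_cornerOf (univUnitary_univRep τ) a

theorem incl_crossedProductCongr (hτ : ∀ t a, τ (α.toAut t a) = β.toAut t (τ a))
    (x : CrossedProduct α) :
    tensorCompactsCongr G τ (incl α x) = incl β (crossedProductCongr hτ x) :=
  (inclOf_crossedProductOfCongr (univUnitary_univRep τ) hτ x).symm

theorem crossedProductCongr_dualAction (hτ : ∀ t a, τ (α.toAut t a) = β.toAut t (τ a))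
    (χ : PontryaginDual G) (x : CrossedProduct α) :
    crossedProductCongr hτ (dualAction α χ x) = dualAction β χ (crossedProductCongr hτ x) :=
  crossedProductOfCongr_dualActionOf (univUnitary_univRep τ) hτ χ x

theorem crossedProductCongr_specProj (hτ : ∀ t a, τ (α.toAut t a) = β.toAut t (τ a))
    (χ : PontryaginDual G) : crossedProductCongr hτ (specProj α χ) = specProj β χ :=
  crossedProductOfCongr_specProjOf (univUnitary_univRep τ) hτ χ

theorem CAction.IsConj.exists_equivariant (h : α.IsConj β) :
    ∃ τ : A ≃⋆ₐ[ℂ] A, ∀ t a, τ (α.toAut t a) = β.toAut t (τ a) := by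
  obtain ⟨σ, hσ⟩ := h
  -- `σ⁻¹ (σ β_t σ⁻¹) = β_t σ⁻¹`.
  refine ⟨σ⁻¹, fun t a => ?_⟩
  rw [hσ, ← StarAlgEquiv.mul_apply, ← StarAlgEquiv.mul_apply]
  congr 1
  group

/-- The square for the inclusion and the square for the corner embedding have the same isomorphism
`τ ⊗ id` of `A ⊗ 𝒦(L²(G))` on the target side. -/
theorem isIota₀_congr (hτ : ∀ t a, τ (α.toAut t a) = β.toAut t (τ a))
    (x : K₀ (CrossedProduct α)) (y : K₀ A) :
    IsIota₀ α x y ↔ IsIota₀ β (K₀.congr (crossedProductCongr hτ) x) (K₀.congr τ y) :=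
  K₀.map_eq_map_iff_congr (incl_crossedProductCongr hτ) (tensorCompactsCongr_corner τ) x y

theorem isIota₁_congr (hτ : ∀ t a, τ (α.toAut t a) = β.toAut t (τ a))
    (x : K₁ (CrossedProduct α)) (y : K₁ A) :
    IsIota₁ α x y ↔ IsIota₁ β (K₁.congr (crossedProductCongr hτ) x) (K₁.congr τ y) :=
  K₁.map_eq_map_iff_congr (incl_crossedProductCongr hτ) (tensorCompactsCongr_corner τ) x y

/-- When the corner embedding induces a bijection, `ι_*` is the function whose graph is the relation
already transported. -/
theorem iota₀_congr (hτ : ∀ t a, τ (α.toAut t a) = β.toAut t (τ a)) (x : K₀ (CrossedProduct α)) :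
    iota₀ β (K₀.congr (crossedProductCongr hτ) x) = K₀.congr τ (iota₀ α x) := by
  by_cases h : Function.Bijective (K₀.map (corner G A))
  · rw [eq_comm, ← isIota₀_iff β h, ← isIota₀_congr, isIota₀_iff α h]
  -- The bijectivity condition depends on `G` and `A` but not on the action, so both sides take the
  -- default value `0`.
  · simp [iota₀, h]

theorem iota₁_congr (hτ : ∀ t a, τ (α.toAut t a) = β.toAut t (τ a)) (x : K₁ (CrossedProduct α)) :
    iota₁ β (K₁.congr (crossedProductCongr hτ) x) = K₁.congr τ (iota₁ α x) := by
  by_cases h : Function.Bijective (K₁.map (corner G A))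
  · rw [eq_comm, ← isIota₁_iff β h, ← isIota₁_congr, isIota₁_iff α h]
  · simp [iota₁, h]

end Main

end CrossedProd

theorem proposition3p1 {A G : Type*}
    [CStarAlgebra A] [PartialOrder A] [StarOrderedRing A]
    [CommGroup G] [TopologicalSpace G] [IsTopologicalGroup G] [CompactSpace G] [T2Space G]
    [MeasurableSpace G] [BorelSpace G]
    (α β : CAction G A) (hαβ : α.IsConj β) :
    (∃ (φ₁ : K₀ (CrossedProduct α) ≃+ K₀ (CrossedProduct β)) (φ₂ : K₀ A ≃+ K₀ A),
      (∀ x, iota₀ β (φ₁ x) = φ₂ (iota₀ α x)) ∧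
      (∀ x y, IsIota₀ α x y ↔ IsIota₀ β (φ₁ x) (φ₂ y)) ∧
      (∀ (χ : PontryaginDual G) (x : K₀ (CrossedProduct α)),
        φ₁ (K₀.map (dualAction α χ) x) = K₀.map (dualAction β χ) (φ₁ x)) ∧
      φ₁ (K₀.ofElem (specProj α 1) (specProj_isStarProjection α 1)) =
        K₀.ofElem (specProj β 1) (specProj_isStarProjection β 1) ∧
      (∀ x, x ∈ K₀.pos (CrossedProduct α) ↔ φ₁ x ∈ K₀.pos (CrossedProduct β)) ∧
      (∀ y, y ∈ K₀.pos A ↔ φ₂ y ∈ K₀.pos A)) ∧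
    (∃ (ψ₁ : K₁ (CrossedProduct α) ≃* K₁ (CrossedProduct β)) (ψ₂ : K₁ A ≃* K₁ A),
      (∀ x, iota₁ β (ψ₁ x) = ψ₂ (iota₁ α x)) ∧
      (∀ x y, IsIota₁ α x y ↔ IsIota₁ β (ψ₁ x) (ψ₂ y)) ∧
      (∀ (χ : PontryaginDual G) (x : K₁ (CrossedProduct α)),
        ψ₁ (K₁.map (dualAction α χ) x) = K₁.map (dualAction β χ) (ψ₁ x))) := by
  obtain ⟨τ, hτ⟩ := hαβ.exists_equivariant
  -- In both degrees the isomorphisms come from the same two algebra isomorphisms, `A ⋊_α G ≅ A ⋊_β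
  -- G` and `τ`.
  exact ⟨⟨K₀.congr (crossedProductCongr hτ), K₀.congr τ, iota₀_congr hτ, isIota₀_congr hτ,
      fun χ => K₀.congr_map (crossedProductCongr_dualAction hτ χ), K₀.map_ofElem _ _ _ _ (crossedProductCongr_specProj hτ 1),
      K₀.mem_pos_iff_congr _, K₀.mem_pos_iff_congr _⟩,
    K₁.congr (crossedProductCongr hτ), K₁.congr τ, iota₁_congr hτ, isIota₁_congr hτ,
    fun χ => K₁.congr_map (crossedProductCongr_dualAction hτ χ)⟩
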